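/- Setting. For a finite set $C\subset\mathbb{R}^d$ of centers let $d(x,C)=\min_{c\in C}\|x-c\|_2$. Let $Y\subset\mathbb{R}^d$ be a finite set with integer weights $w(y)\ge 0$, read as a multiset with $w(y)$ copies of each $y\in Y$ (all weights are $1$ for an unweighted set). For real $z\ge 0$ let $f^Y_z(C)$ be the sum of $d(y,C)^2$ over the copies that remain when the $z$ (for non-integral $z$: $\lfloor z\rfloor$) copies with the largest $d(y,C)$ are discarded (all copies, if there are no more than $z$). A set of $k$ centers is a nonempty set of at most $k$ points of $\mathbb{R}^d$ (i.e. $k$ centers, repetitions allowed), and $\mathrm{Opt}(Y,k,z)=\inf_C f^Y_z(C)$ over all sets $C$ of $k$ centers. The instance $(Y,k,z')$ is an $(\alpha,\beta)$-coreset for $(X,k,z)$ if for all real $\kappa_1,\kappa_2\ge 1$ and every set $C$ of $k$ centers, $$f^Y_{\kappa_1 z'}(C)\le\kappa_2\,\mathrm{Opt}(Y,k,z')\quad\Longrightarrow\quad f^X_{\alpha\kappa_1 z}(C)\le\beta\kappa_2\,\mathrm{Opt}(X,k,z).$$ Algorithms. $k$-means++$(X,m)$, for a finite set $X\subset\mathbb{R}^d$,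 picks $m$ centers from $X$ one after another, the first uniformly at random and each further one equal to $x\in X$ with probability proportional to $d(x,Y)^2$, where $Y$ is the set of centers picked so far; it stops early once every point of $X$ is a center. Its output is the set $Y$ of the centers picked, where $y\in Y$ has as weight the number of points of $X$ assigned to it when each point of $X$ is assigned to a nearest element of $Y$, ties being broken by an arbitrary fixed rule. SampleCoreset$(X,k,z)$, with $n=|X|$, sets $$p=\max\Bigl(\tfrac{36}{z}\log\tfrac{4nk^2}{z},\ \tfrac{36k}{z}\log(2k^3)\Bigr)\qquad(p=\infty\text{ if }z=0).$$ If $p>1$, it outputs $Y=k$-means++$(X,32(k+z))$, and we put $z'=z$. If $p\le 1$, it draws $S\subseteq X$ containing each $x\in X$ independently with probability $p$ and outputs $Y=k$-means++$(S,\lceil 32(k+2.5pz)\rceil)$, and we put $z'=2.5pz$. Theorem. There are absolute constants $c,\alpha,\beta,K>0$ such that for all integers $d,z\ge 0$ and $k\ge 1$, every finite set $X\subset\mathbb{R}^d$ with $n=|X|$, and every tie-breaking rule, the output $Y$ of SampleCoreset$(X,k,z)$ satisfies: 1. with probability at least $c$, the instance $(Y,k,z')$ is an $(\alpha,\beta)$-coreset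 for $(X,k,z)$; 2. if $n\ge 2$, then the expected number of (distinct) points of $Y$ is at most $K\,k\log n$. -/

import Mathlib

open scoped NNReal ENNReal

noncomputable section

/-- A finite set of points with nonnegative integer weights: a point `y` of weight `w` stands for
`w` copies of `y`.  Only the weights of the elements of `points` matter. -/
@[ext] structure WeightedPoints (E : Type*) where
  points : Finset E
  weight : E → ℕ

/-- An unweighted finite set: every point has weight one. -/
def WeightedPoints.ofFinset {E : Type*} (X : Finset E) : WeightedPoints E where
  points := X
  weight := fun _ => 1

/-- The assignment cost `d(x, C) ^ 2` of the point `x` to the centers `C`. -/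
def assignCost {E : Type*} [MetricSpace E] (C : Finset E) (x : E) : ℝ :=
  (Metric.infDist x (C : Set E)) ^ 2

/-- The ways to keep `v y` of the `w y` copies of each point `y` of `Y` such that at most `z`
copies in total (that is, at most `⌊z⌋` of them) are discarded. -/
def keepChoices {E : Type*} (Y : WeightedPoints E) (z : ℝ) : Set (E → ℕ) :=
  {v | (∀ y ∈ Y.points, v y ≤ Y.weight y) ∧
    ∑ y ∈ Y.points, Y.weight y ≤ ∑ y ∈ Y.points, v y + ⌊z⌋₊}

/-- The `z`-cost of the centers `C` on `Y`: the total assignment cost of the copies that remain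
when the `z` most expensive copies are discarded, i.e. the least possible total assignment cost
when at most `z` copies are discarded. -/
def outlierCost {E : Type*} [MetricSpace E] (Y : WeightedPoints E) (z : ℝ) (C : Finset E) : ℝ :=
  ⨅ v : keepChoices Y z, ∑ y ∈ Y.points, (v.1 y : ℝ) * assignCost C y

/-- Collections of `k` centers.  Centers may coincide, so as a set it is nonempty and has at most
`k` elements. -/
def IsCenterSet {E : Type*} (k : ℕ) (C : Finset E) : Prop :=
  C.Nonempty ∧ C.card ≤ k

/-- The optimal value of the `k`-means with outliers instance `(Y, k, z)`. -/
def optCost {E : Type*} [MetricSpace E] (Y : WeightedPoints E) (k : ℕ) (z : ℝ) : ℝ :=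
  ⨅ C : {C : Finset E // IsCenterSet k C}, outlierCost Y z C.1

/-- `(Y, k, z')` is an `(α, β)`-coreset for `(X, k, z)`: every `(κ₁, κ₂)`-approximate solution of
the former is an `(α κ₁, β κ₂)`-approximate solution of the latter. -/
def IsCoreset {E : Type*} [MetricSpace E] (k : ℕ) (Y : WeightedPoints E) (z' : ℝ)
    (X : WeightedPoints E) (z : ℝ) (α β : ℝ) : Prop :=
  ∀ κ₁ κ₂ : ℝ, 1 ≤ κ₁ → 1 ≤ κ₂ → ∀ C : Finset E, IsCenterSet k C →
    outlierCost Y (κ₁ * z') C ≤ κ₂ * optCost Y k z' →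
      outlierCost X (α * κ₁ * z) C ≤ β * κ₂ * optCost X k z

/-- A rule that assigns each point `x` to a nearest element of `Y`, ties being broken in an
arbitrary but fixed way. -/
def IsNearestRule {E : Type*} [MetricSpace E] (near : Finset E → E → E) : Prop :=
  ∀ Y : Finset E, Y.Nonempty → ∀ x : E, near Y x ∈ Y ∧ ∀ y ∈ Y, dist x (near Y x) ≤ dist x y

/-- Unnormalized probability with which `k`-means++ picks `x` as its next center when the centers
`Y` have already been picked: uniform on `X` for the first center, afterwards proportional to the
squared distance to `Y`. -/
def seedWeight {E : Type*} [MetricSpace E] (X Y : Finset E) (x : E) : ℝ≥0∞ :=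
  open Classical in
  if x ∈ X then (if Y = ∅ then 1 else ENNReal.ofReal (assignCost Y x)) else 0

theorem seedWeight_tsum_ne_top {E : Type*} [MetricSpace E] (X Y : Finset E) :
    ∑' x, seedWeight X Y x ≠ ⊤ := by
  classical
  rw [tsum_eq_sum (s := X) (fun x hx => by simp [seedWeight, hx])]
  refine ENNReal.sum_ne_top.2 fun x hx => ?_
  by_cases hY : Y = ∅ <;> simp [seedWeight, hx, hY]

/-- One step of `k`-means++: the law of the centers after one more pick.  If there is nothing left
to pick (every point of `X` is already a center), the centers stay as they are. -/
def kmeansPPStep {E : Type*} [MetricSpace E] (X Y : Finset E) : PMF (Finset E) :=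
  open Classical in
  if h : ∑' x, seedWeight X Y x = 0 then PMF.pure Y
  else (PMF.normalize (seedWeight X Y) h (seedWeight_tsum_ne_top X Y)).map (fun x => insert x Y)

/-- The law of the set of centers that `k`-means++ picks from `X` in `m` steps. -/
def kmeansPPCenters {E : Type*} [MetricSpace E] (X : Finset E) : ℕ → PMF (Finset E)
  | 0 => PMF.pure ∅
  | m + 1 => (kmeansPPCenters X m).bind (kmeansPPStep X)

/-- The centers `Y`, each weighted by the number of points of `X` that are assigned to it. -/
def clusterWeights {E : Type*} (near : Finset E → E → E) (X Y : Finset E) : WeightedPoints E where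
  points := Y
  weight := fun y => open Classical in (X.filter (fun x => near Y x = y)).card

/-- The law of the weighted output of `k`-means++ with `m` centers on `X`. -/
def kmeansPP {E : Type*} [MetricSpace E] (near : Finset E → E → E) (X : Finset E) (m : ℕ) :
    PMF (WeightedPoints E) :=
  (kmeansPPCenters X m).map (clusterWeights near X)

/-- The law of the random subset of `X` that contains each element of `X` independently with
probability `p`. -/
def bernoulliSubset {E : Type*} (X : Finset E) (p : ℝ≥0) (hp : p ≤ 1) : PMF (Finset E) :=
  open Classical in
  PMF.ofFinset
    (fun S => if S ⊆ X then (p : ℝ≥0∞) ^ S.card * ((1 - p : ℝ≥0) : ℝ≥0∞) ^ (X.card - S.card) else 0)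
    X.powerset
    (by
      rw [Finset.sum_congr rfl (fun S hS => if_pos (Finset.mem_powerset.1 hS)),
        Finset.sum_pow_mul_eq_add_pow, ← ENNReal.coe_add, add_tsub_cancel_of_le hp]
      simp)
    (fun S hS => if_neg (fun h => hS (Finset.mem_powerset.2 h)))

/-- The sampling rate `p = max (36/z · log (4nk²/z), 36k/z · log (2k³))`, for `z ≠ 0`. -/
def sampleRate (n k z : ℕ) : ℝ :=
  max (36 / (z : ℝ) * Real.log (4 * n * k ^ 2 / z)) (36 * (k / z : ℝ) * Real.log (2 * k ^ 3))

/-- The input is subsampled when `p ≤ 1`; for `z = 0` the rate `p` is infinite. -/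
def Subsamples (n k z : ℕ) : Prop :=
  z ≠ 0 ∧ sampleRate n k z ≤ 1

/-- The number `z'` of outliers of the instance `(Y, k, z')` that SampleCoreset outputs. -/
def coresetOutliers (n k z : ℕ) : ℝ :=
  open Classical in
  if Subsamples n k z then 5 / 2 * sampleRate n k z * z else z

/-- The law of the weighted set that SampleCoreset outputs on the instance `(X, k, z)`. -/
def sampleCoreset {E : Type*} [MetricSpace E] (near : Finset E → E → E) (X : Finset E)
    (k z : ℕ) : PMF (WeightedPoints E) :=
  open Classical in
  if h : Subsamples X.card k z then
    (bernoulliSubset X (sampleRate X.card k z).toNNReal (Real.toNNReal_le_one.2 h.2)).bind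
      (fun S => kmeansPP near S ⌈32 * ((k : ℝ) + 5 / 2 * sampleRate X.card k z * z)⌉₊)
  else kmeansPP near X (32 * (k + z))

end

/-! ### Costs with outliers, near-optimal solutions, composition of coresets -/

section CostBasics

variable {E : Type*}

/-! Two coreset constructions are composed. Since the coreset property is quantified over all `κ₁`
and `κ₂`, the constants simply multiply (`IsCoreset.trans`).

k-means++: the outliers of a near-optimal solution are treated as extra centers. The resulting
reference set has at most k + z elements and serves all of X at cost at most 4 Opt. A reference
cluster is bad if the centers picked so far pay more than 42 times its reference cost. As long as
the total cost exceeds 84 times the reference cost, a step cures a bad cluster with probability at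
least 1/4 (`expect_step_card_badClusters`), and once centers exist no cured cluster becomes bad
again. So about 32(k + z) steps reach cost O(Opt) with constant probability. Moving every point to
its nearest picked center then distorts every cost by a factor 2 and an additive O(Opt), for any
number of discarded points (`isCoreset_clusterWeights`).

Sampling: fix a near-optimal C with outliers O. Markov's inequality bounds the sampled outliers and
the cost of the sampled inliers; a Chernoff bound ensures that each cluster with at least z/k
inliers is sampled at density at least p/8. These events involve only C and O, so no union bound
over candidate solutions D is needed. Given D and the sampled points it discards, drop from X the
set O, the small clusters, and the large clusters that lost at least half of their sampled points:
O(κ₁ z) points in all. Every other cluster retains enough sampled points to bound the cost of D at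
its center, hence on the whole cluster (`IsFaithfulSample.outlierCost_le`).

The size bound holds surely, because pz = O(k log n) when 1 ≤ k ≤ n, n ≥ 2 and z ≠ 0. -/

theorem weight_mem_keepChoices (Y : WeightedPoints E) (z : ℝ) : Y.weight ∈ keepChoices Y z :=
  ⟨fun _ _ => le_rfl, Nat.le_add_right _ _⟩

instance (Y : WeightedPoints E) (z : ℝ) : Nonempty (keepChoices Y z) :=
  ⟨⟨_, weight_mem_keepChoices Y z⟩⟩

variable [MetricSpace E]

theorem assignCost_nonneg (C : Finset E) (x : E) : 0 ≤ assignCost C x := sq_nonneg _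

theorem assignCost_le_dist_sq {C : Finset E} {c : E} (hc : c ∈ C) (x : E) :
    assignCost C x ≤ dist x c ^ 2 :=
  pow_le_pow_left₀ Metric.infDist_nonneg (Metric.infDist_le_dist_of_mem (by simpa using hc)) 2

theorem assignCost_near {near : Finset E → E → E} (hnear : IsNearestRule near) {C : Finset E}
    (hC : C.Nonempty) (x : E) : assignCost C x = dist x (near C x) ^ 2 := by
  refine le_antisymm (assignCost_le_dist_sq (hnear C hC x).1 x) ?_
  refine pow_le_pow_left₀ dist_nonneg ?_ 2
  exact (Metric.le_infDist (by simpa using hC)).2 fun y hy => (hnear C hC x).2 y (by simpa using hy)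

/-- The distance to a set is 1-Lipschitz, and (a + b)² ≤ 2a² + 2b². This relaxed triangle inequality
is the source of most constants below. -/
theorem assignCost_le_two_mul (C : Finset E) (x y : E) :
    assignCost C x ≤ 2 * assignCost C y + 2 * dist x y ^ 2 := by
  have h : Metric.infDist x (C : Set E) ≤ Metric.infDist y C + dist x y :=
    Metric.infDist_le_infDist_add_dist
  have h2 := pow_le_pow_left₀ Metric.infDist_nonneg h 2
  unfold assignCost
  nlinarith [sq_nonneg (Metric.infDist y (C : Set E) - dist x y)]

/-- Nonemptiness matters: `Metric.infDist` to the empty set is 0, so adding a first center may raise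
the cost. -/
theorem assignCost_anti {C D : Finset E} (hC : C.Nonempty) (h : C ⊆ D) (x : E) :
    assignCost D x ≤ assignCost C x :=
  pow_le_pow_left₀ Metric.infDist_nonneg
    (Metric.infDist_le_infDist_of_subset (by simpa using h) (by simpa using hC)) 2

theorem assignCost_eq_zero {C : Finset E} {x : E} (hx : x ∈ C) : assignCost C x = 0 := by
  have := assignCost_le_dist_sq hx x
  simp only [dist_self] at this
  exact le_antisymm (by simpa using this) (assignCost_nonneg _ _)

theorem outlierCost_le {Y : WeightedPoints E} {z : ℝ} (C : Finset E) {v : E → ℕ}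
    (hv : v ∈ keepChoices Y z) :
    outlierCost Y z C ≤ ∑ y ∈ Y.points, (v y : ℝ) * assignCost C y := by
  refine ciInf_le (f := fun v : keepChoices Y z =>
    ∑ y ∈ Y.points, (v.1 y : ℝ) * assignCost C y) ⟨0, ?_⟩ ⟨v, hv⟩
  rintro _ ⟨w, rfl⟩
  exact Finset.sum_nonneg fun y _ => mul_nonneg (Nat.cast_nonneg _) (assignCost_nonneg _ _)

theorem le_outlierCost {Y : WeightedPoints E} {z a : ℝ} {C : Finset E}
    (h : ∀ v ∈ keepChoices Y z, a ≤ ∑ y ∈ Y.points, (v y : ℝ) * assignCost C y) :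
    a ≤ outlierCost Y z C :=
  le_ciInf fun v => h v.1 v.2

theorem outlierCost_nonneg (Y : WeightedPoints E) (z : ℝ) (C : Finset E) :
    0 ≤ outlierCost Y z C :=
  le_outlierCost fun _ _ =>
    Finset.sum_nonneg fun _ _ => mul_nonneg (Nat.cast_nonneg _) (assignCost_nonneg _ _)

theorem outlierCost_anti (Y : WeightedPoints E) {z z' : ℝ} (h : z ≤ z') (C : Finset E) :
    outlierCost Y z' C ≤ outlierCost Y z C :=
  le_outlierCost fun _ hv =>
    outlierCost_le C ⟨hv.1, hv.2.trans (Nat.add_le_add_left (Nat.floor_mono h) _)⟩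

theorem optCost_le (Y : WeightedPoints E) {k : ℕ} (z : ℝ) {C : Finset E} (hC : IsCenterSet k C) :
    optCost Y k z ≤ outlierCost Y z C := by
  refine ciInf_le (f := fun C : {C : Finset E // IsCenterSet k C} => outlierCost Y z C.1)
    ⟨0, ?_⟩ ⟨C, hC⟩
  rintro _ ⟨w, rfl⟩
  exact outlierCost_nonneg _ _ _

theorem optCost_nonneg (Y : WeightedPoints E) (k : ℕ) (z : ℝ) : 0 ≤ optCost Y k z :=
  Real.iInf_nonneg fun _ => outlierCost_nonneg _ _ _

/-- In an empty space there are no center sets and the real infimum takes its default value 0; hence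
`Nonempty E` and `1 ≤ k`. -/
theorem le_optCost [Nonempty E] {Y : WeightedPoints E} {k : ℕ} (hk : 1 ≤ k) {z a : ℝ}
    (h : ∀ C : Finset E, IsCenterSet k C → a ≤ outlierCost Y z C) : a ≤ optCost Y k z := by
  obtain ⟨e⟩ := ‹Nonempty E›
  have : Nonempty {C : Finset E // IsCenterSet k C} := ⟨⟨{e}, by simp [IsCenterSet, hk]⟩⟩
  exact le_ciInf fun C => h C.1 C.2

theorem outlierCost_of_points_empty {Y : WeightedPoints E} (hY : Y.points = ∅) (z : ℝ)
    (C : Finset E) : outlierCost Y z C = 0 := by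
  simp [outlierCost, hY]

theorem isCoreset_empty (k : ℕ) (Y : WeightedPoints E) (z z' : ℝ) {α β : ℝ} (hβ : 0 ≤ β) :
    IsCoreset k Y z' (WeightedPoints.ofFinset ∅) z α β := by
  intro κ₁ κ₂ _ h₂ C _ _
  rw [outlierCost_of_points_empty rfl]
  exact mul_nonneg (mul_nonneg hβ (by linarith)) (optCost_nonneg _ _ _)

theorem IsCoreset.mono {k : ℕ} {Y X : WeightedPoints E} {z' z α β α' β' : ℝ}
    (h : IsCoreset k Y z' X z α β) (hz : 0 ≤ z) (hα : α ≤ α') (hβ : β ≤ β') :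
    IsCoreset k Y z' X z α' β' := by
  intro κ₁ κ₂ h₁ h₂ C hC hle
  refine (outlierCost_anti X ?_ C).trans ((h κ₁ κ₂ h₁ h₂ C hC hle).trans ?_)
  · have : 0 ≤ κ₁ := by linarith
    gcongr
  · have : 0 ≤ κ₂ := by linarith
    have := optCost_nonneg X k z
    gcongr

/-- The guarantee of the first coreset is fed into the second with parameters `α₁ * κ₁` and `β₁ *
κ₂`. These are admissible only if they are at least 1, whence the bounds on `α₁` and `β₁`. -/
theorem IsCoreset.trans {k : ℕ} {Y S X : WeightedPoints E} {z'' z' z α₁ β₁ α₂ β₂ : ℝ}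
    (h₁ : IsCoreset k Y z'' S z' α₁ β₁) (h₂ : IsCoreset k S z' X z α₂ β₂)
    (hα : 1 ≤ α₁) (hβ : 1 ≤ β₁) :
    IsCoreset k Y z'' X z (α₁ * α₂) (β₁ * β₂) := by
  intro κ₁ κ₂ hκ₁ hκ₂ C hC hle
  have := h₂ (α₁ * κ₁) (β₁ * κ₂) (one_le_mul_of_one_le_of_one_le hα hκ₁)
    (one_le_mul_of_one_le_of_one_le hβ hκ₂) C hC (h₁ κ₁ κ₂ hκ₁ hκ₂ C hC hle)
  convert this using 2 <;> ring

/-- Near-optimal centers and outliers can be chosen among the points themselves. -/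
theorem exists_centers_outliers [DecidableEq E] {near : Finset E → E → E} (hnear : IsNearestRule near)
    {X : Finset E} (hX : X.Nonempty) {k : ℕ} (hk : 1 ≤ k) (z : ℝ) :
    ∃ C O : Finset E, IsCenterSet k C ∧ O ⊆ X ∧ O.card ≤ ⌊z⌋₊ ∧
      ∑ x ∈ X \ O, assignCost C x ≤ 4 * optCost (WeightedPoints.ofFinset X) k z := by
  classical
  let P : Finset (Finset E × Finset E) := (X.powerset ×ˢ X.powerset).filter
    fun q => IsCenterSet k q.1 ∧ q.2.card ≤ ⌊z⌋₊
  obtain ⟨e, he⟩ := hX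
  have hP : P.Nonempty := ⟨({e}, ∅), by
    rw [Finset.mem_filter]
    simp [he, IsCenterSet, hk]⟩
  -- There are only finitely many pairs of subsets of `X`, so a minimum is attained without any
  -- compactness argument.
  obtain ⟨⟨C, O⟩, hCO, hmin⟩ :=
    P.exists_min_image (fun q => ∑ x ∈ X \ q.2, assignCost q.1 x) hP
  simp only [P, Finset.mem_filter, Finset.mem_product, Finset.mem_powerset] at hCO hmin
  refine ⟨C, O, hCO.2.1, hCO.1.2, hCO.2.2, ?_⟩
  have : Nonempty E := ⟨e⟩
  suffices h : (∑ x ∈ X \ O, assignCost C x) / 4 ≤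
      optCost (WeightedPoints.ofFinset X) k z by linarith
  refine le_optCost hk fun D hD => le_outlierCost fun v hv => ?_
  simp only [WeightedPoints.ofFinset, keepChoices, Set.mem_ofPred_eq] at hv ⊢
  have hXne : X.Nonempty := ⟨e, he⟩
  -- Snapping a center to its nearest point of `X` at most doubles its distance to any point of `X`,
  -- which costs the factor 4 after squaring.
  have h1 := hmin (D.image (near X), X.filter (fun x => v x = 0)) ⟨⟨?_, Finset.filter_subset _ _⟩,
    ⟨hD.1.image _, Finset.card_image_le.trans hD.2⟩, ?_⟩
  · have h2 : ∑ x ∈ X \ X.filter (fun x => v x = 0), assignCost (D.image (near X)) x ≤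
        ∑ x ∈ X, 4 * ((v x : ℝ) * assignCost D x) := by
      refine (Finset.sum_le_sum (g := fun x => 4 * ((v x : ℝ) * assignCost D x)) ?_).trans
        (Finset.sum_le_sum_of_subset_of_nonneg Finset.sdiff_subset ?_)
      · intro x hx
        simp only [Finset.mem_sdiff, Finset.mem_filter, not_and] at hx
        have hvx : (1 : ℝ) ≤ v x := by exact_mod_cast Nat.one_le_iff_ne_zero.2 (hx.2 hx.1)
        have h3 := assignCost_le_dist_sq
          (Finset.mem_image_of_mem (near X) (hnear D hD.1 x).1) x
        have h4 : dist x (near X (near D x)) ≤ 2 * dist x (near D x) := by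
          have h5 := (hnear X hXne (near D x)).2 x hx.1
          have h6 := dist_triangle x (near D x) (near X (near D x))
          rw [dist_comm (near D x) x] at h5
          linarith
        have h7 := pow_le_pow_left₀ dist_nonneg h4 2
        have h8 := assignCost_near hnear hD.1 x
        have h9 := assignCost_nonneg D x
        nlinarith
      · intro x _ _
        exact mul_nonneg (by norm_num) (mul_nonneg (Nat.cast_nonneg _) (assignCost_nonneg _ _))
    rw [← Finset.mul_sum] at h2
    have h3 := h1.trans h2
    linarith
  · intro y hy
    obtain ⟨c, _, rfl⟩ := Finset.mem_image.1 hy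
    exact (hnear X hXne c).1
  · have h2 : ∑ y ∈ X, 1 = ∑ y ∈ X, v y + (X.filter (fun x => v x = 0)).card := by
      rw [Finset.card_filter, ← Finset.sum_add_distrib]
      refine Finset.sum_congr rfl fun x hx => ?_
      have := hv.1 x hx
      split_ifs <;> omega
    have := hv.2
    simp only [] at *
    omega

/-- Moving each point to its nearest element of `Y`, read backwards. -/
theorem outlierCost_le_clusterWeights {near : Finset E → E → E} (hnear : IsNearestRule near)
    (X : Finset E) {Y : Finset E} (hY : Y.Nonempty) (z : ℝ) (C : Finset E) :
    outlierCost (WeightedPoints.ofFinset X) z C ≤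
      2 * outlierCost (clusterWeights near X Y) z C + 2 * ∑ x ∈ X, assignCost Y x := by
  classical
  suffices h : (outlierCost (WeightedPoints.ofFinset X) z C - 2 * ∑ x ∈ X, assignCost Y x) / 2 ≤
      outlierCost (clusterWeights near X Y) z C by linarith
  refine le_outlierCost fun v hv => ?_
  simp only [clusterWeights, keepChoices, Set.mem_ofPred_eq] at hv ⊢
  -- The `v y` kept copies of `y` are realized by `v y` actual points assigned to `y`; exactly these
  -- points are kept in `X`.
  have hT : ∀ y, ∃ T ⊆ X.filter (fun x => near Y x = y), y ∈ Y → T.card = v y := by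
    intro y
    by_cases hy : y ∈ Y
    · obtain ⟨T, hT, hc⟩ := Finset.exists_subset_card_eq (hv.1 y hy)
      exact ⟨T, by convert hT, fun _ => hc⟩
    · exact ⟨∅, by simp, fun h => absurd h hy⟩
  choose T hT hTc using hT
  let u : E → ℕ := fun x => if x ∈ T (near Y x) then 1 else 0
  have hmaps : ∀ x ∈ X, near Y x ∈ Y := fun x _ => (hnear Y hY x).1
  have hu : ∀ y ∈ Y, ∑ x ∈ X with near Y x = y, u x = v y := by
    intro y hy
    rw [← hTc y hy, Finset.card_eq_sum_ones, ← Finset.sum_filter_add_sum_filter_not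
      (X.filter (fun x => near Y x = y)) (fun x => x ∈ T y)]
    have h1 : (X.filter (fun x => near Y x = y)).filter (fun x => x ∈ T y) = T y := by
      ext x
      simp only [Finset.mem_filter]
      exact ⟨fun h => h.2, fun h => ⟨Finset.mem_filter.1 (hT y h), h⟩⟩
    rw [h1, Finset.sum_eq_zero (s := Finset.filter (fun x => x ∉ T y) _), add_zero]
    · refine Finset.sum_congr rfl fun x hx => ?_
      simp [u, (Finset.mem_filter.1 (hT y hx)).2, hx]
    · intro x hx
      simp only [Finset.mem_filter] at hx
      simp [u, hx.1.2, hx.2]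
  have hmem : u ∈ keepChoices (WeightedPoints.ofFinset X) z := by
    refine ⟨fun x _ => ?_, ?_⟩
    · simp only [u, WeightedPoints.ofFinset]; split_ifs <;> simp
    · simp only [WeightedPoints.ofFinset]
      rw [← Finset.card_eq_sum_ones, Finset.card_eq_sum_card_fiberwise hmaps,
        ← Finset.sum_fiberwise_of_maps_to hmaps, Finset.sum_congr rfl hu]
      convert hv.2
  have h1 := outlierCost_le C hmem
  simp only [WeightedPoints.ofFinset] at h1 
  have h2 : ∑ x ∈ X, (u x : ℝ) * assignCost C x ≤
      ∑ x ∈ X, (2 * ((u x : ℝ) * assignCost C (near Y x)) + 2 * assignCost Y x) := by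
    refine Finset.sum_le_sum fun x _ => ?_
    have h3 := assignCost_le_two_mul C x (near Y x)
    rw [← assignCost_near hnear hY] at h3
    have h4 := assignCost_nonneg Y x
    by_cases hx : x ∈ T (near Y x) <;> simp only [u, hx, if_true, if_false] <;> push_cast <;>
      linarith
  rw [Finset.sum_add_distrib, ← Finset.mul_sum, ← Finset.mul_sum,
    ← Finset.sum_fiberwise_of_maps_to hmaps (fun x => (u x : ℝ) * assignCost C (near Y x))] at h2
  have h3 : ∑ y ∈ Y, ∑ x ∈ X with near Y x = y, (u x : ℝ) * assignCost C (near Y x) =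
      ∑ y ∈ Y, (v y : ℝ) * assignCost C y := by
    refine Finset.sum_congr rfl fun y hy => ?_
    rw [← hu y hy, Nat.cast_sum, Finset.sum_mul]
    refine Finset.sum_congr rfl fun x hx => ?_
    rw [(Finset.mem_filter.1 hx).2]
  rw [h3] at h2
  simp only [WeightedPoints.ofFinset]
  linarith

/-- Moving each point to its nearest element of `Y`. -/
theorem clusterWeights_outlierCost_le {near : Finset E → E → E} (hnear : IsNearestRule near)
    (X : Finset E) {Y : Finset E} (hY : Y.Nonempty) (z : ℝ) (C : Finset E) :
    outlierCost (clusterWeights near X Y) z C ≤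
      2 * outlierCost (WeightedPoints.ofFinset X) z C + 2 * ∑ x ∈ X, assignCost Y x := by
  classical
  suffices h : (outlierCost (clusterWeights near X Y) z C - 2 * ∑ x ∈ X, assignCost Y x) / 2 ≤
      outlierCost (WeightedPoints.ofFinset X) z C by linarith
  refine le_outlierCost fun u hu => ?_
  simp only [WeightedPoints.ofFinset, keepChoices, Set.mem_ofPred_eq] at hu ⊢
  have hmaps : ∀ x ∈ X, near Y x ∈ Y := fun x _ => (hnear Y hY x).1
  have hmem : (fun y => ∑ x ∈ X with near Y x = y, u x) ∈
      keepChoices (clusterWeights near X Y) z := by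
    simp only [clusterWeights, keepChoices, Set.mem_ofPred_eq]
    constructor
    · intro y _
      rw [Finset.card_eq_sum_ones]
      refine (Finset.sum_le_sum fun x hx => hu.1 x (Finset.mem_filter.1 hx).1).trans (le_of_eq ?_)
      rfl
    · rw [Finset.sum_fiberwise_of_maps_to hmaps]
      refine le_trans (le_of_eq ?_) hu.2
      rw [← Finset.card_eq_sum_ones, Finset.card_eq_sum_card_fiberwise hmaps]
  have h1 := outlierCost_le C hmem
  have h2 : ∑ y ∈ Y, ((∑ x ∈ X with near Y x = y, u x : ℕ) : ℝ) * assignCost C y =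
      ∑ x ∈ X, (u x : ℝ) * assignCost C (near Y x) := by
    rw [← Finset.sum_fiberwise_of_maps_to hmaps (fun x => (u x : ℝ) * assignCost C (near Y x))]
    refine Finset.sum_congr rfl fun y hy => ?_
    rw [Nat.cast_sum, Finset.sum_mul]
    refine Finset.sum_congr rfl fun x hx => ?_
    rw [(Finset.mem_filter.1 hx).2]
  have h3 : ∑ x ∈ X, (u x : ℝ) * assignCost C (near Y x) ≤
      ∑ x ∈ X, (2 * ((u x : ℝ) * assignCost C x) + 2 * assignCost Y x) := by
    refine Finset.sum_le_sum fun x hx => ?_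
    have h4 := assignCost_le_two_mul C (near Y x) x
    rw [dist_comm, ← assignCost_near hnear hY] at h4
    have h5 := assignCost_nonneg Y x
    have h6 : (u x : ℝ) ≤ 1 := by exact_mod_cast hu.1 x hx
    have h7 : (0 : ℝ) ≤ u x := Nat.cast_nonneg _
    nlinarith
  rw [Finset.sum_add_distrib, ← Finset.mul_sum, ← Finset.mul_sum] at h3
  have h4 : (clusterWeights near X Y).points = Y := rfl
  rw [h4, h2] at h1
  linarith

/-- The two transfer inequalities give Opt(Y) ≤ (2 + 2B) Opt(X) and f^X ≤ 2 f^Y + 2B Opt(X). Hence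
the factor 2(2 + 2B) + 2B = 4 + 6B, with no loss in the number of outliers. -/
theorem isCoreset_clusterWeights {near : Finset E → E → E} (hnear : IsNearestRule near)
    (X : Finset E) {Y : Finset E} (hY : Y.Nonempty) {k : ℕ} (hk : 1 ≤ k) (z : ℝ) {B : ℝ}
    (hB : 0 ≤ B)
    (h : ∑ x ∈ X, assignCost Y x ≤ B * optCost (WeightedPoints.ofFinset X) k z) :
    IsCoreset k (clusterWeights near X Y) z (WeightedPoints.ofFinset X) z 1 (4 + 6 * B) := by
  intro κ₁ κ₂ _ h₂ C _ hle
  have : Nonempty E := hY.to_type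
  have h1 := outlierCost_le_clusterWeights hnear X hY (κ₁ * z) C
  have h3 : (optCost (clusterWeights near X Y) k z - 2 * ∑ x ∈ X, assignCost Y x) / 2 ≤
      optCost (WeightedPoints.ofFinset X) k z := by
    refine le_optCost hk fun D hD => ?_
    have := clusterWeights_outlierCost_le hnear X hY z D
    have := optCost_le (clusterWeights near X Y) z hD
    linarith
  rw [one_mul]
  have h4 := optCost_nonneg (WeightedPoints.ofFinset X) k z
  have h5 := mul_nonneg hB h4
  have h6 : κ₂ * optCost (clusterWeights near X Y) k z ≤
      κ₂ * (2 * optCost (WeightedPoints.ofFinset X) k z +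
        2 * (B * optCost (WeightedPoints.ofFinset X) k z)) :=
    mul_le_mul_of_nonneg_left (by linarith) (by linarith)
  nlinarith

end CostBasics

/-! ### Expectations and tail bounds for discrete laws -/

section Expectation

variable {α β : Type*}

/-- The expectation of a nonnegative function under a discrete law. -/
noncomputable def PMF.expect (p : PMF α) (f : α → ℝ≥0∞) : ℝ≥0∞ := ∑' a, p a * f a

namespace PMF

theorem expect_mono (p : PMF α) {f g : α → ℝ≥0∞} (h : ∀ a, p a ≠ 0 → f a ≤ g a) :
    p.expect f ≤ p.expect g := by
  refine ENNReal.tsum_le_tsum fun a => ?_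
  by_cases ha : p a = 0
  · simp [ha]
  · gcongr; exact h a ha

theorem expect_congr (p : PMF α) {f g : α → ℝ≥0∞} (h : ∀ a, p a ≠ 0 → f a = g a) :
    p.expect f = p.expect g :=
  le_antisymm (p.expect_mono fun a ha => (h a ha).le) (p.expect_mono fun a ha => (h a ha).ge)

theorem expect_const (p : PMF α) (c : ℝ≥0∞) : p.expect (fun _ => c) = c := by
  simp [expect, ENNReal.tsum_mul_right, p.tsum_coe]

theorem expect_add (p : PMF α) (f g : α → ℝ≥0∞) :
    p.expect (fun a => f a + g a) = p.expect f + p.expect g := by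
  simp [expect, mul_add, ENNReal.tsum_add]

theorem expect_finset_sum {ι : Type*} (p : PMF α) (s : Finset ι) (f : ι → α → ℝ≥0∞) :
    p.expect (fun a => ∑ i ∈ s, f i a) = ∑ i ∈ s, p.expect (f i) := by
  simp only [expect, Finset.mul_sum]
  exact Summable.tsum_finsetSum fun _ _ => ENNReal.summable

theorem expect_const_mul (p : PMF α) (c : ℝ≥0∞) (f : α → ℝ≥0∞) :
    p.expect (fun a => c * f a) = c * p.expect f := by
  simp only [expect, ← ENNReal.tsum_mul_left]
  exact tsum_congr fun a => by ring

theorem expect_pure (a : α) (f : α → ℝ≥0∞) : (pure a).expect f = f a := by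
  classical
  rw [expect, tsum_eq_single a]
  · simp
  · intro b hb; simp [pure_apply, hb]

theorem expect_bind (p : PMF α) (q : α → PMF β) (f : β → ℝ≥0∞) :
    (p.bind q).expect f = p.expect fun a => (q a).expect f := by
  simp only [expect, bind_apply, ← ENNReal.tsum_mul_left, ← ENNReal.tsum_mul_right]
  rw [ENNReal.tsum_comm]
  exact tsum_congr fun a => tsum_congr fun b => by ring

theorem expect_map (p : PMF α) (g : α → β) (f : β → ℝ≥0∞) :
    (p.map g).expect f = p.expect fun a => f (g a) := by
  simp only [← bind_pure_comp, expect_bind, Function.comp_apply, expect_pure]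

theorem toOuterMeasure_eq_expect (p : PMF α) (s : Set α) :
    p.toOuterMeasure s = p.expect (s.indicator 1) := by
  rw [toOuterMeasure_apply, expect]
  refine tsum_congr fun a => ?_
  by_cases ha : a ∈ s <;> simp [ha]

theorem one_sub_le_toOuterMeasure (p : PMF α) (s : Set α) {b : ℝ≥0∞}
    (h : p.toOuterMeasure sᶜ ≤ b) : 1 - b ≤ p.toOuterMeasure s := by
  have h1 : p.toOuterMeasure s + p.toOuterMeasure sᶜ = 1 := by
    rw [toOuterMeasure_eq_expect, toOuterMeasure_eq_expect, ← expect_add, ← p.expect_const 1]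
    congr 1
    funext a
    by_cases ha : a ∈ s <;> simp [ha]
  rw [tsub_le_iff_right, ← h1]
  gcongr

theorem markov (p : PMF α) (f : α → ℝ≥0∞) {t b : ℝ≥0∞} (ht : t ≠ 0) (ht' : t ≠ ⊤)
    (h : p.expect f ≤ t * b) : p.toOuterMeasure {a | t ≤ f a} ≤ b := by
  have h1 : t * p.toOuterMeasure {a | t ≤ f a} ≤ t * b := by
    refine le_trans ?_ h
    rw [toOuterMeasure_eq_expect, ← expect_const_mul]
    refine p.expect_mono fun a _ => ?_
    by_cases ha : t ≤ f a <;> simp [ha]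
  exact (ENNReal.mul_le_mul_iff_right ht ht').1 h1

/-- Success probabilities of consecutive stages multiply when the second bound holds after every
successful first stage. -/
theorem mul_le_toOuterMeasure_bind (p : PMF α) (q : α → PMF β) (s : Set α) (t : Set β)
    {a b : ℝ≥0∞} (hs : a ≤ p.toOuterMeasure s) (hq : ∀ x ∈ s, b ≤ (q x).toOuterMeasure t) :
    a * b ≤ (p.bind q).toOuterMeasure t := by
  rw [toOuterMeasure_eq_expect, expect_bind]
  calc a * b ≤ p.expect (s.indicator 1) * b := by
        rw [← toOuterMeasure_eq_expect]; gcongr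
    _ = p.expect (fun x => b * s.indicator 1 x) := by rw [expect_const_mul, mul_comm]
    _ ≤ _ := by
        refine p.expect_mono fun x _ => ?_
        by_cases hx : x ∈ s
        · simpa [hx, toOuterMeasure_eq_expect] using hq x hx
        · simp [hx]

theorem le_toOuterMeasure_of_support (p : PMF α) {s : Set α} (h : ∀ a, p a ≠ 0 → a ∈ s) :
    1 ≤ p.toOuterMeasure s := by
  rw [toOuterMeasure_eq_expect, ← p.expect_const 1]
  exact p.expect_mono fun a ha => by simp [h a ha]

end PMF

end Expectation

/-! ### k-means++ as a bicriteria approximation -/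

section KMeansPP

variable {E : Type*} [MetricSpace E]

/-- If a cluster is expensive for `Y`, at least half of its cost stems from points whose addition
to `Y` makes the cluster cheap. -/
theorem half_cost_le_sum_good [DecidableEq E] (A : Finset E) (c : E) {Y : Finset E}
    (h : 42 * ∑ x ∈ A, dist x c ^ 2 < ∑ x ∈ A, assignCost Y x) :
    (∑ x ∈ A, assignCost Y x) / 2 ≤
      ∑ x ∈ A with ∑ a ∈ A, assignCost (insert x Y) a ≤ 42 * ∑ a ∈ A, dist a c ^ 2,
        assignCost Y x := by
  classical
  set Δ := ∑ x ∈ A, dist x c ^ 2 with hΔ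
  set Q := ∑ x ∈ A, assignCost Y x with hQ
  have hΔ0 : 0 ≤ Δ := Finset.sum_nonneg fun _ _ => sq_nonneg _
  set D := assignCost Y c with hD
  have hD0 : 0 ≤ D := assignCost_nonneg _ _
  have h1 : Q ≤ 2 * (A.card * D) + 2 * Δ := by
    have := Finset.sum_le_sum fun x (_ : x ∈ A) => assignCost_le_two_mul Y x c
    rw [Finset.sum_add_distrib, ← Finset.mul_sum, ← Finset.mul_sum, Finset.sum_const,
      nsmul_eq_mul] at this
    exact this
  have h2 : A.card * D ≤ 2 * Q + 2 * Δ := by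
    have := Finset.sum_le_sum fun x (_ : x ∈ A) => assignCost_le_two_mul Y c x
    simp only [dist_comm c] at this
    rw [Finset.sum_add_distrib, ← Finset.mul_sum, ← Finset.mul_sum, Finset.sum_const,
      nsmul_eq_mul] at this
    exact this
  -- `F` consists of the points whose squared distance to `c` exceeds 16 times the average, so it
  -- has at most |A|/16 elements. Its cost is at most |A|D/8 + 2Δ ≤ Q/4 + 9Δ/4 ≤ Q/2. Any point
  -- outside `F`, taken as a center, serves the cluster at cost at most 2Δ + 32Δ ≤ 42Δ.
  set F := A.filter fun x => 16 * Δ < A.card * dist x c ^ 2 with hF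
  have hFΔ : ∑ x ∈ F, dist x c ^ 2 ≤ Δ :=
    Finset.sum_le_sum_of_subset_of_nonneg (Finset.filter_subset _ _) fun _ _ _ => sq_nonneg _
  have hFcard : 16 * (F.card : ℝ) ≤ A.card := by
    rcases hΔ0.eq_or_lt with h0 | h0
    · have : F = ∅ := by
        refine Finset.filter_eq_empty_iff.2 fun x hx => ?_
        have := (Finset.sum_eq_zero_iff_of_nonneg fun _ _ => sq_nonneg _).1 h0.symm x hx
        simp [this, ← h0]
      simp [this]
    · have h3 : ∑ x ∈ F, 16 * Δ ≤ ∑ x ∈ F, A.card * dist x c ^ 2 :=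
        Finset.sum_le_sum fun x hx => (Finset.mem_filter.1 hx).2.le
      rw [Finset.sum_const, nsmul_eq_mul, ← Finset.mul_sum] at h3
      have h4 : (A.card : ℝ) * ∑ x ∈ F, dist x c ^ 2 ≤ A.card * Δ := by gcongr
      refine le_of_mul_le_mul_right ?_ h0
      linarith
  have hFcost : ∑ x ∈ F, assignCost Y x ≤ 2 * (F.card * D) + 2 * Δ := by
    have := Finset.sum_le_sum fun x (_ : x ∈ F) => assignCost_le_two_mul Y x c
    rw [Finset.sum_add_distrib, ← Finset.mul_sum, ← Finset.mul_sum, Finset.sum_const,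
      nsmul_eq_mul] at this
    linarith
  have hsplit := Finset.sum_filter_add_sum_filter_not A
    (fun x => 16 * Δ < A.card * dist x c ^ 2) (assignCost Y)
  have hgood : ∑ x ∈ A with ¬ (16 * Δ < A.card * dist x c ^ 2), assignCost Y x ≤
      ∑ x ∈ A with ∑ a ∈ A, assignCost (insert x Y) a ≤ 42 * Δ, assignCost Y x := by
    refine Finset.sum_le_sum_of_subset_of_nonneg ?_ fun _ _ _ => assignCost_nonneg _ _
    intro x hx
    simp only [Finset.mem_filter, not_lt] at hx ⊢
    refine ⟨hx.1, ?_⟩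
    have h3 : ∑ a ∈ A, assignCost (insert x Y) a ≤
        ∑ a ∈ A, (2 * dist a c ^ 2 + 2 * dist x c ^ 2) := by
      refine Finset.sum_le_sum fun a _ =>
        (assignCost_le_dist_sq (Finset.mem_insert_self x Y) a).trans ?_
      have h4 := dist_triangle a c x
      rw [dist_comm c x] at h4
      nlinarith [pow_le_pow_left₀ dist_nonneg h4 2, sq_nonneg (dist a c - dist x c)]
    rw [Finset.sum_add_distrib, ← Finset.mul_sum, Finset.sum_const, nsmul_eq_mul] at h3
    linarith [hx.2]
  have h5 : 16 * (F.card : ℝ) * D ≤ A.card * D := by gcongr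
  linarith

open Classical in
/-- The clusters of `C` in `X` for which the centers `Y` are expensive. -/
noncomputable def badClusters (near : Finset E → E → E) (X C Y : Finset E) : Finset E :=
  C.filter fun c => 42 * ∑ x ∈ X with near C x = c, dist x c ^ 2 <
    ∑ x ∈ X with near C x = c, assignCost Y x

open Classical in
/-- The indicator of the event that the centers `Y` are expensive compared with `C`. -/
noncomputable def expensive (X C Y : Finset E) : ℝ≥0∞ :=
  if 84 * ∑ x ∈ X, assignCost C x < ∑ x ∈ X, assignCost Y x then 1 else 0

variable {near : Finset E → E → E}

theorem badClusters_insert_subset [DecidableEq E] (X C : Finset E) {Y : Finset E}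
    (hY : Y.Nonempty) (x : E) : badClusters near X C (insert x Y) ⊆ badClusters near X C Y := by
  classical
  intro c hc
  simp only [badClusters, Finset.mem_filter] at hc ⊢
  exact ⟨hc.1, hc.2.trans_le (Finset.sum_le_sum fun a _ =>
    assignCost_anti hY (Finset.subset_insert x Y) a)⟩

theorem expensive_insert_le [DecidableEq E] (X C : Finset E) {Y : Finset E}
    (hY : Y.Nonempty) (x : E) : expensive X C (insert x Y) ≤ expensive X C Y := by
  have h : ∑ a ∈ X, assignCost (insert x Y) a ≤ ∑ a ∈ X, assignCost Y a :=
    Finset.sum_le_sum fun a _ => assignCost_anti hY (Finset.subset_insert x Y) a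
  unfold expensive
  split_ifs with h1 h2
  · rfl
  · exact absurd (h1.trans_le h) h2
  · exact zero_le
  · rfl

/-- With reference cost Δ_c and current cost Q_c of cluster c, the curing points in c have cost at
least (Q_c - 42Δ_c)/2: this is `half_cost_le_sum_good` for bad clusters and trivial for the others,
where it is not positive. Summing gives (Q - 42Δ)/2, and 42Δ < Q/2. -/
theorem quarter_cost_le_sum_good [DecidableEq E] (hnear : IsNearestRule near) (X : Finset E)
    {C Y : Finset E} (hC : C.Nonempty)
    (h : 84 * ∑ x ∈ X, assignCost C x < ∑ x ∈ X, assignCost Y x) :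
    (∑ x ∈ X, assignCost Y x) / 4 ≤ ∑ x ∈ X with
      ∃ c ∈ badClusters near X C Y, c ∉ badClusters near X C (insert x Y), assignCost Y x := by
  classical
  have hmaps : ∀ x ∈ X, near C x ∈ C := fun x _ => (hnear C hC x).1
  set B := badClusters near X C Y with hB
  have hΔ : ∑ c ∈ C, ∑ x ∈ X with near C x = c, dist x c ^ 2 = ∑ x ∈ X, assignCost C x := by
    rw [← Finset.sum_fiberwise_of_maps_to hmaps]
    refine Finset.sum_congr rfl fun c _ => Finset.sum_congr rfl fun x hx => ?_
    rw [assignCost_near hnear hC, (Finset.mem_filter.1 hx).2]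
  have hQ : ∑ c ∈ C, ∑ x ∈ X with near C x = c, assignCost Y x = ∑ x ∈ X, assignCost Y x :=
    Finset.sum_fiberwise_of_maps_to hmaps _
  have hnonneg : ∀ x, 0 ≤ assignCost Y x := assignCost_nonneg Y
  have key : ∀ c ∈ C, (∑ x ∈ X with near C x = c, assignCost Y x -
      42 * ∑ x ∈ X with near C x = c, dist x c ^ 2) / 2 ≤
      ∑ x ∈ X with near C x = c,
        if ∃ c ∈ B, c ∉ badClusters near X C (insert x Y) then assignCost Y x else 0 := by
    intro c hc
    have hΔ0 : 0 ≤ ∑ x ∈ X with near C x = c, dist x c ^ 2 :=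
      Finset.sum_nonneg fun _ _ => sq_nonneg _
    by_cases hcB : 42 * ∑ x ∈ X with near C x = c, dist x c ^ 2 <
        ∑ x ∈ X with near C x = c, assignCost Y x
    · refine le_trans ?_ ((half_cost_le_sum_good _ c hcB).trans ?_)
      · linarith
      · rw [Finset.sum_filter]
        refine Finset.sum_le_sum fun x _ => ?_
        by_cases hx : ∑ a ∈ X with near C a = c, assignCost (insert x Y) a ≤
            42 * ∑ a ∈ X with near C a = c, dist a c ^ 2
        · rw [if_pos hx, if_pos]
          refine ⟨c, ?_, ?_⟩
          · simp only [hB, badClusters, Finset.mem_filter]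
            exact ⟨hc, by convert hcB⟩
          · simp only [badClusters, Finset.mem_filter, not_and, not_lt]
            exact fun _ => le_trans (le_of_eq (by congr!)) (hx.trans (le_of_eq (by congr!)))
        · rw [if_neg hx]
          split_ifs
          exacts [hnonneg x, le_rfl]
    · refine le_trans ?_ (Finset.sum_nonneg fun x _ => ?_)
      · linarith
      · split_ifs
        exacts [hnonneg x, le_rfl]
  have hsum := Finset.sum_le_sum key
  rw [Finset.sum_fiberwise_of_maps_to hmaps, ← Finset.sum_div, Finset.sum_sub_distrib,
    ← Finset.mul_sum, hΔ, hQ] at hsum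
  rw [Finset.sum_filter]
  linarith

theorem PMF.expect_normalize {α : Type*} (f : α → ℝ≥0∞) (h0 : ∑' x, f x ≠ 0)
    (h : ∑' x, f x ≠ ⊤) (g : α → ℝ≥0∞) :
    (PMF.normalize f h0 h).expect g = (∑' x, f x * g x) * (∑' x, f x)⁻¹ := by
  simp only [PMF.expect, PMF.normalize_apply, ← ENNReal.tsum_mul_right]
  exact tsum_congr fun a => by ring

theorem tsum_seedWeight_mul (X : Finset E) {Y : Finset E} (hY : Y.Nonempty) (g : E → ℝ≥0∞) :
    ∑' x, seedWeight X Y x * g x = ∑ x ∈ X, ENNReal.ofReal (assignCost Y x) * g x := by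
  rw [tsum_eq_sum (s := X) fun x hx => by simp [seedWeight, hx]]
  exact Finset.sum_congr rfl fun x hx => by simp [seedWeight, hx, hY.ne_empty]

theorem tsum_seedWeight (X : Finset E) {Y : Finset E} (hY : Y.Nonempty) :
    ∑' x, seedWeight X Y x = ENNReal.ofReal (∑ x ∈ X, assignCost Y x) := by
  rw [ENNReal.ofReal_sum_of_nonneg fun _ _ => assignCost_nonneg _ _]
  simpa using tsum_seedWeight_mul X hY 1

/-- One step of `k`-means++ decreases the expected number of bad clusters. -/
theorem expect_step_card_badClusters (hnear : IsNearestRule near) (X : Finset E)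
    {C Y : Finset E} (hC : C.Nonempty) (hY : Y.Nonempty) :
    (kmeansPPStep X Y).expect (fun Y => ((badClusters near X C Y).card : ℝ≥0∞)) +
      1 / 4 * expensive X C Y ≤ (badClusters near X C Y).card := by
  classical
  unfold kmeansPPStep
  split_ifs with h0
  · rw [PMF.expect_pure]
    rw [tsum_seedWeight X hY, ENNReal.ofReal_eq_zero] at h0
    have : expensive X C Y = 0 := by
      refine if_neg (not_lt.2 (h0.trans ?_))
      exact mul_nonneg (by norm_num) (Finset.sum_nonneg fun _ _ => assignCost_nonneg _ _)
    simp [this]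
  · rw [PMF.expect_map]
    set p := PMF.normalize (seedWeight X Y) h0 (seedWeight_tsum_ne_top X Y) with hp
    let good : E → ℝ≥0∞ := fun x =>
      if ∃ c ∈ badClusters near X C Y, c ∉ badClusters near X C (insert x Y) then 1 else 0
    have h1 : 1 / 4 * expensive X C Y ≤ p.expect good := by
      by_cases hexp : 84 * ∑ x ∈ X, assignCost C x < ∑ x ∈ X, assignCost Y x
      · rw [expensive, if_pos hexp, mul_one, hp, PMF.expect_normalize,
          tsum_seedWeight_mul X hY, tsum_seedWeight X hY]
        have hpos : 0 < ∑ x ∈ X, assignCost Y x :=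
          lt_of_le_of_lt (mul_nonneg (by norm_num)
            (Finset.sum_nonneg fun _ _ => assignCost_nonneg _ _)) hexp
        rw [← div_eq_mul_inv, ENNReal.le_div_iff_mul_le (by simp [hpos]) (by simp)]
        have h2 := ENNReal.ofReal_le_ofReal (quarter_cost_le_sum_good hnear X hC hexp)
        rw [Finset.sum_filter, ENNReal.ofReal_sum_of_nonneg] at h2
        · refine le_trans (le_of_eq ?_) (h2.trans (Finset.sum_le_sum fun x _ => ?_))
          · rw [ENNReal.ofReal_div_of_pos (by norm_num), mul_comm, ← mul_div_assoc, mul_one]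
            norm_num
          · simp only [good]
            split_ifs <;> simp
        · intro x _
          split_ifs
          exacts [assignCost_nonneg _ _, le_rfl]
      · simp [expensive, hexp]
    refine (add_le_add_right h1 _).trans ?_
    rw [← PMF.expect_add]
    refine (p.expect_mono fun x _ => ?_).trans (p.expect_const _).le
    have hsub := badClusters_insert_subset (near := near) X C hY x
    simp only [good]
    split_ifs with hx
    · obtain ⟨c, hc, hc'⟩ := hx
      have := Finset.card_lt_card (Finset.ssubset_iff_of_subset hsub |>.2 ⟨c, hc, hc'⟩)
      exact_mod_cast this
    · rw [add_zero]
      exact_mod_cast Finset.card_le_card hsub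

theorem expect_step_expensive (X C : Finset E) {Y : Finset E} (hY : Y.Nonempty) :
    (kmeansPPStep X Y).expect (expensive X C) ≤ expensive X C Y := by
  classical
  unfold kmeansPPStep
  split_ifs with h0
  · rw [PMF.expect_pure]
  · rw [PMF.expect_map]
    exact (PMF.expect_mono _ fun x _ => expensive_insert_le X C hY x).trans
      (PMF.expect_const _ _).le

/-- A step of `k`-means++ keeps the centers or adds a point of `X`. -/
theorem kmeansPPStep_support [DecidableEq E] {X Y Z : Finset E} (h : kmeansPPStep X Y Z ≠ 0) :
    (Z = Y ∧ (X.Nonempty → Y.Nonempty)) ∨ ∃ x ∈ X, Z = insert x Y := by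
  classical
  unfold kmeansPPStep at h
  split_ifs at h with h0
  · left
    rw [← PMF.mem_support_iff, PMF.mem_support_pure_iff] at h
    refine ⟨h, fun hX => ?_⟩
    by_contra hY
    rw [Finset.not_nonempty_iff_eq_empty] at hY
    obtain ⟨x, hx⟩ := hX
    have := ENNReal.tsum_eq_zero.1 h0 x
    simp [seedWeight, hx, hY] at this
  · right
    rw [← PMF.mem_support_iff, PMF.mem_support_map_iff] at h
    obtain ⟨x, hx, rfl⟩ := h
    rw [PMF.mem_support_normalize_iff] at hx
    refine ⟨x, ?_, by congr!⟩
    by_contra hxX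
    simp [seedWeight, hxX] at hx

theorem kmeansPPCenters_support {X : Finset E} :
    ∀ {m : ℕ} {Y : Finset E}, kmeansPPCenters X m Y ≠ 0 →
      Y ⊆ X ∧ Y.card ≤ m ∧ (X.Nonempty → m ≠ 0 → Y.Nonempty)
  | 0, Y, h => by
    rw [kmeansPPCenters, ← PMF.mem_support_iff, PMF.mem_support_pure_iff] at h
    simp [h]
  | m + 1, Z, h => by
    classical
    rw [kmeansPPCenters, ← PMF.mem_support_iff, PMF.mem_support_bind_iff] at h
    obtain ⟨Y, hY, hZ⟩ := h
    obtain ⟨h1, h2, _⟩ := kmeansPPCenters_support ((PMF.mem_support_iff _ _).1 hY)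
    rcases kmeansPPStep_support ((PMF.mem_support_iff _ _).1 hZ) with ⟨rfl, h3⟩ | ⟨x, hx, rfl⟩
    · exact ⟨h1, h2.trans (Nat.le_succ m), fun hX _ => h3 hX⟩
    · exact ⟨Finset.insert_subset hx h1, (Finset.card_insert_le _ _).trans (by omega),
        fun _ _ => Finset.insert_nonempty _ _⟩

/-- A potential argument: each step from nonempty centers lowers the expected number of bad clusters
by at least a quarter of the probability of being expensive before it. That probability never
increases, so the last one bounds all earlier ones from below. The uniform first pick contributes
nothing to the count; it only makes the centers nonempty. -/
theorem expect_kmeansPPCenters_le (hnear : IsNearestRule near) {X C : Finset E}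
    (hX : X.Nonempty) (hC : C.Nonempty) (m : ℕ) :
    (kmeansPPCenters X (m + 1)).expect (fun Y => ((badClusters near X C Y).card : ℝ≥0∞)) +
      m / 4 * (kmeansPPCenters X (m + 1)).expect (expensive X C) ≤ C.card := by
  classical
  induction m with
  | zero =>
    simp only [Nat.cast_zero, ENNReal.zero_div, zero_mul, add_zero]
    refine (PMF.expect_mono _ fun Y _ => ?_).trans (PMF.expect_const _ _).le
    exact_mod_cast Finset.card_filter_le _ _
  | succ m ih =>
    have hne : ∀ Y, kmeansPPCenters X (m + 1) Y ≠ 0 → Y.Nonempty := fun Y hY =>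
      (kmeansPPCenters_support hY).2.2 hX (Nat.succ_ne_zero m)
    rw [kmeansPPCenters, PMF.expect_bind, PMF.expect_bind]
    set p := kmeansPPCenters X (m + 1) with hp
    have h1 : p.expect (fun Y => (kmeansPPStep X Y).expect (expensive X C)) ≤
        p.expect (expensive X C) := p.expect_mono fun Y hY => expect_step_expensive X C (hne Y hY)
    have h2 := p.expect_mono fun Y hY => expect_step_card_badClusters hnear X hC (hne Y hY)
    rw [PMF.expect_add, PMF.expect_const_mul] at h2
    calc _ ≤ p.expect (fun Y => (kmeansPPStep X Y).expect
              fun Y => ((badClusters near X C Y).card : ℝ≥0∞)) +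
            ((m + 1 : ℕ) : ℝ≥0∞) / 4 * p.expect (expensive X C) := by gcongr
      _ = p.expect (fun Y => (kmeansPPStep X Y).expect
              fun Y => ((badClusters near X C Y).card : ℝ≥0∞)) +
            1 / 4 * p.expect (expensive X C) + m / 4 * p.expect (expensive X C) := by
          rw [add_assoc, ← add_mul, ← ENNReal.add_div]
          push_cast
          rw [add_comm (m : ℝ≥0∞)]
      _ ≤ _ := (add_le_add_left h2 _).trans ih

/-- `k`-means++ with `m` centers is with high probability a bicriteria approximation. -/
theorem kmeansPPCenters_expensive_le (hnear : IsNearestRule near) {X C : Finset E}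
    (hX : X.Nonempty) (hC : C.Nonempty) {m : ℕ} (hm : 31 * C.card < m) :
    (kmeansPPCenters X m).toOuterMeasure
      {Y | 84 * ∑ x ∈ X, assignCost C x < ∑ x ∈ X, assignCost Y x} ≤ 4 / 31 := by
  classical
  -- Apart from the first pick at least 31|C| steps remain, so the potential bound `m / 4 * a ≤ |C|`
  -- yields `a ≤ 4 / 31`.
  obtain ⟨m, rfl⟩ : ∃ n, m = n + 1 := ⟨m - 1, by omega⟩
  have h := le_trans le_add_self (expect_kmeansPPCenters_le hnear hX hC m)
  set a := (kmeansPPCenters X (m + 1)).expect (expensive X C) with ha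
  have h1 : (kmeansPPCenters X (m + 1)).toOuterMeasure
      {Y | 84 * ∑ x ∈ X, assignCost C x < ∑ x ∈ X, assignCost Y x} = a := by
    rw [PMF.toOuterMeasure_eq_expect]
    congr 1
  rw [h1]
  have hc : (C.card : ℝ≥0∞) ≠ 0 := by exact_mod_cast hC.card_pos.ne'
  rw [ENNReal.le_div_iff_mul_le (by simp) (by simp)]
  have hm' : (31 * C.card : ℝ≥0∞) ≤ m := by exact_mod_cast Nat.lt_succ_iff.1 hm
  refine (ENNReal.mul_le_mul_iff_right hc (by simp)).1 ?_
  calc (C.card : ℝ≥0∞) * (a * 31) = 31 * C.card * a := by ring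
    _ ≤ m * a := by gcongr
    _ = (m / 4 * a) * 4 := by
      rw [mul_right_comm, ENNReal.div_mul_cancel (by simp) (by simp)]
    _ ≤ C.card * 4 := by gcongr

/-- `k`-means++ with `32 (k + z)` centers yields a coreset. -/
theorem kmeansPP_isCoreset (hnear : IsNearestRule near) (X : Finset E) {k m : ℕ} (hk : 1 ≤ k)
    (z : ℝ) (hm : 32 * (k + ⌊z⌋₊) ≤ m) :
    1 - 4 / 31 ≤ (kmeansPP near X m).toOuterMeasure
      {Y | IsCoreset k Y z (WeightedPoints.ofFinset X) z 1 2020} := by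
  classical
  rcases X.eq_empty_or_nonempty with rfl | hX
  · exact tsub_le_self.trans (PMF.le_toOuterMeasure_of_support _ fun Y _ =>
      isCoreset_empty k Y z z (by norm_num))
  obtain ⟨C, O, hC, -, hO, hcost⟩ := exists_centers_outliers hnear hX hk z
  -- Outliers are free once they are centers themselves.
  have hle : ∑ x ∈ X, assignCost (C ∪ O) x ≤ ∑ x ∈ X \ O, assignCost C x := by
    rw [← Finset.sum_subset (Finset.sdiff_subset (s := X) (t := O))]
    · exact Finset.sum_le_sum fun x _ => assignCost_anti hC.1 Finset.subset_union_left x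
    · intro x hx hx'
      refine assignCost_eq_zero (Finset.mem_union_right _ ?_)
      simpa [hx] using hx'
  have hcard : (C ∪ O).card ≤ k + ⌊z⌋₊ :=
    (Finset.card_union_le _ _).trans (add_le_add hC.2 hO)
  have h := kmeansPPCenters_expensive_le hnear hX
    (hC.1.mono Finset.subset_union_left : (C ∪ O).Nonempty) (m := m) (by omega)
  rw [kmeansPP, PMF.toOuterMeasure_map_apply]
  refine (PMF.one_sub_le_toOuterMeasure _
    {Y | ∑ x ∈ X, assignCost Y x ≤ 84 * ∑ x ∈ X, assignCost (C ∪ O) x} ?_).trans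
    (PMF.toOuterMeasure_mono _ ?_)
  · simpa only [Set.compl_ofPred, not_le] using h
  · rintro Y ⟨hY, hYs⟩
    have hYne := (kmeansPPCenters_support ((PMF.mem_support_iff _ _).1 hYs)).2.2 hX (by omega)
    -- 336 = 84 · 4 combines the k-means++ factor with the loss in `exists_centers_outliers`; then 4
    -- + 6 · 336 = 2020.
    have := isCoreset_clusterWeights hnear X hYne hk z (B := 336) (by norm_num) (by
      change ∑ x ∈ X, assignCost Y x ≤ _ at hY
      linarith)
    norm_num at this
    exact this

end KMeansPP

/-! ### Bernoulli samples: moments and tail bounds -/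

section Sampling

variable {E : Type*}

theorem expect_bernoulliSubset (X : Finset E) (p : ℝ≥0) (hp : p ≤ 1) (f : Finset E → ℝ≥0∞) :
    (bernoulliSubset X p hp).expect f = ∑ S ∈ X.powerset,
      (p : ℝ≥0∞) ^ S.card * ((1 - p : ℝ≥0) : ℝ≥0∞) ^ (X.card - S.card) * f S := by
  classical
  rw [PMF.expect, tsum_eq_sum (s := X.powerset)]
  · refine Finset.sum_congr rfl fun S hS => ?_
    rw [bernoulliSubset, PMF.ofFinset_apply, if_pos (Finset.mem_powerset.1 hS)]
  · intro S hS
    rw [bernoulliSubset, PMF.ofFinset_apply, if_neg (by simpa using hS), zero_mul]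

theorem bernoulliSubset_support {X S : Finset E} {p : ℝ≥0} {hp : p ≤ 1}
    (h : bernoulliSubset X p hp S ≠ 0) : S ⊆ X := by
  classical
  by_contra hS
  rw [bernoulliSubset, PMF.ofFinset_apply, if_neg hS] at h
  exact h rfl

/-- Expanding the product over `X` of two-term sums gives one term per subset. This generating
function expresses independence and supplies both the marginals and the Chernoff bound. -/
theorem expect_bernoulliSubset_prod (X : Finset E) (p : ℝ≥0) (hp : p ≤ 1) (a : E → ℝ≥0∞) :
    (bernoulliSubset X p hp).expect (fun S => ∏ x ∈ S, a x) =
      ∏ x ∈ X, (p * a x + (1 - p : ℝ≥0)) := by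
  classical
  rw [expect_bernoulliSubset, Finset.prod_add]
  refine Finset.sum_congr rfl fun S hS => ?_
  rw [Finset.prod_mul_distrib, Finset.prod_const, Finset.prod_const,
    Finset.card_sdiff_of_subset (Finset.mem_powerset.1 hS)]
  ring

theorem expect_bernoulliSubset_mem [DecidableEq E] {X : Finset E} (p : ℝ≥0) (hp : p ≤ 1) {x : E}
    (hx : x ∈ X) : (bernoulliSubset X p hp).expect (fun S => if x ∈ S then 1 else 0) = p := by
  have h1 : (bernoulliSubset X p hp).expect (fun S => if x ∈ S then 0 else 1) =
      (1 - p : ℝ≥0) := by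
    -- A factor 0 at `x` and 1 elsewhere turns the product into the indicator of `x ∉ S`.
    have h := expect_bernoulliSubset_prod X p hp (fun y => if y = x then 0 else 1)
    have h2 : ∀ S : Finset E, (∏ y ∈ S, if y = x then (0 : ℝ≥0∞) else 1) =
        if x ∈ S then 0 else 1 := by
      intro S
      split_ifs with hS
      · exact Finset.prod_eq_zero hS (by simp)
      · exact Finset.prod_eq_one fun y hy => if_neg fun (h : y = x) => hS (h ▸ hy)
    simp only [h2] at h
    rw [h, Finset.prod_eq_single x]
    · simp
    · intro y _ hy
      rw [if_neg hy, mul_one, ← ENNReal.coe_add, add_tsub_cancel_of_le hp, ENNReal.coe_one]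
    · exact fun h => absurd hx h
  have h2 : (bernoulliSubset X p hp).expect (fun S => if x ∈ S then 1 else 0) +
      (1 - p : ℝ≥0) = p + (1 - p : ℝ≥0) := by
    rw [← h1, ← PMF.expect_add, h1, ← ENNReal.coe_add, add_tsub_cancel_of_le hp]
    refine Eq.trans ?_ (PMF.expect_const (bernoulliSubset X p hp) 1)
    congr 1
    funext S
    split_ifs <;> simp
  exact (ENNReal.add_left_inj (by simp)).1 h2

theorem expect_bernoulliSubset_sum (X : Finset E) (p : ℝ≥0) (hp : p ≤ 1) (g : E → ℝ≥0∞) :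
    (bernoulliSubset X p hp).expect (fun S => ∑ x ∈ S, g x) = p * ∑ x ∈ X, g x := by
  classical
  have h1 : (bernoulliSubset X p hp).expect (fun S => ∑ x ∈ S, g x) =
      (bernoulliSubset X p hp).expect (fun S => ∑ x ∈ X, g x * if x ∈ S then 1 else 0) := by
    refine PMF.expect_congr _ fun S hS => ?_
    simp only [mul_ite, mul_one, mul_zero]
    rw [Finset.sum_ite_mem, Finset.inter_eq_right.2 (bernoulliSubset_support hS)]
  rw [h1, PMF.expect_finset_sum, Finset.mul_sum]
  refine Finset.sum_congr rfl fun x hx => ?_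
  rw [PMF.expect_const_mul, expect_bernoulliSubset_mem p hp hx, mul_comm]

/-- Markov's inequality for the sum of a nonnegative function over a random subset. -/
theorem bernoulliSubset_sum_gt_le (X : Finset E) {p : ℝ≥0} (hp : p ≤ 1) (hp0 : 0 < p)
    {g : E → ℝ} (hg : ∀ x, 0 ≤ g x) {L M : ℝ} (hL : 0 < L) (hM : ∑ x ∈ X, g x ≤ M) :
    (bernoulliSubset X p hp).toOuterMeasure {S | L * (p * M) < ∑ x ∈ S, g x} ≤
      ENNReal.ofReal (1 / L) := by
  have hM0 : 0 ≤ M := (Finset.sum_nonneg fun x _ => hg x).trans hM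
  have hp0' : (0 : ℝ) < p := hp0
  -- Markov's inequality needs a positive threshold; for `M = 0` the sum vanishes on every sample.
  rcases hM0.eq_or_lt with rfl | hMpos
  · refine le_trans (PMF.toOuterMeasure_mono _ (t := ∅) ?_) (by simp)
    rintro S ⟨hS, hS'⟩
    have h1 := Finset.sum_le_sum_of_subset_of_nonneg
      (bernoulliSubset_support ((PMF.mem_support_iff _ _).1 hS')) fun x _ _ => hg x
    change L * (p * 0) < ∑ x ∈ S, g x at hS
    simp only [mul_zero] at hS
    linarith
  · have hpos : 0 < L * (p * M) := by positivity
    refine le_trans ((bernoulliSubset X p hp).toOuterMeasure.mono ?_)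
      (PMF.markov _ (fun S => ∑ x ∈ S, ENNReal.ofReal (g x))
        (t := ENNReal.ofReal (L * (p * M))) (by simpa using hpos) (by simp) ?_)
    · intro S hS
      change L * (p * M) < ∑ x ∈ S, g x at hS
      change ENNReal.ofReal (L * (p * M)) ≤ ∑ x ∈ S, ENNReal.ofReal (g x)
      rw [← ENNReal.ofReal_sum_of_nonneg fun x _ => hg x]
      exact ENNReal.ofReal_le_ofReal hS.le
    · rw [expect_bernoulliSubset_sum, ← ENNReal.ofReal_sum_of_nonneg fun x _ => hg x,
        ← ENNReal.ofReal_mul hpos.le, ← ENNReal.ofReal_coe_nnreal,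
        ← ENNReal.ofReal_mul hp0'.le]
      refine ENNReal.ofReal_le_ofReal ?_
      have : L * (p * M) * (1 / L) = p * M := by field_simp
      rw [this]
      gcongr

/-- A Chernoff bound: a random subset of density `p` contains at least `p * |A| / 8` elements of
`A` with high probability. -/
theorem bernoulliSubset_card_inter_lt_le [DecidableEq E] {X A : Finset E} (hA : A ⊆ X) {p : ℝ≥0}
    (hp : p ≤ 1) :
    (bernoulliSubset X p hp).toOuterMeasure {S | ((S ∩ A).card : ℝ) < p * A.card / 8} ≤
      ENNReal.ofReal (Real.exp (-(3 / 8 * (p * A.card)))) := by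
  -- Markov's inequality for 2^(-|S ∩ A|), whose mean is (1 - p/2)^|A| ≤ exp(-p|A|/2). On the event
  -- it is at least exp(-p|A|/8), as 1/2 ≥ 1/e; the exponents differ by 3p|A|/8.
  refine le_trans ((bernoulliSubset X p hp).toOuterMeasure.mono ?_)
      (PMF.markov _ (fun S => ∏ x ∈ S, if x ∈ A then (1 / 2 : ℝ≥0∞) else 1)
        (t := ENNReal.ofReal (Real.exp (-(p * A.card / 8)))) (by simp [Real.exp_pos]) (by simp) ?_)
  · intro S hS
    change ((S ∩ A).card : ℝ) < p * A.card / 8 at hS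
    change ENNReal.ofReal (Real.exp (-(p * A.card / 8))) ≤
      ∏ x ∈ S, if x ∈ A then (1 / 2 : ℝ≥0∞) else 1
    rw [Finset.prod_ite_mem, Finset.prod_const]
    have h1 : (1 / 2 : ℝ≥0∞) = ENNReal.ofReal (1 / 2) := by
      rw [ENNReal.ofReal_div_of_pos (by norm_num)]; simp
    rw [h1, ← ENNReal.ofReal_pow (by norm_num)]
    refine ENNReal.ofReal_le_ofReal ?_
    calc Real.exp (-(p * A.card / 8)) ≤ Real.exp (((S ∩ A).card : ℝ) * (-1)) :=
          Real.exp_le_exp.2 (by linarith)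
      _ = Real.exp (-1) ^ (S ∩ A).card := Real.exp_nat_mul _ _
      _ ≤ (1 / 2) ^ (S ∩ A).card := by
          refine pow_le_pow_left₀ (Real.exp_pos _).le ?_ _
          rw [Real.exp_neg, ← one_div]
          refine one_div_le_one_div_of_le (by norm_num) ?_
          have := Real.add_one_le_exp 1
          linarith
  · rw [expect_bernoulliSubset_prod]
    have h1 : ∀ x ∈ X, (p : ℝ≥0∞) * (if x ∈ A then (1 / 2 : ℝ≥0∞) else 1) + (1 - p : ℝ≥0) =
        if x ∈ A then ENNReal.ofReal (1 - p / 2) else 1 := by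
      intro x _
      have hp' : (p : ℝ) ≤ 1 := hp
      have h2 : ((1 - p : ℝ≥0) : ℝ≥0∞) = ENNReal.ofReal (1 - p) := by
        rw [← ENNReal.ofReal_coe_nnreal, NNReal.coe_sub hp, NNReal.coe_one]
      rw [h2, ← ENNReal.ofReal_coe_nnreal]
      split_ifs
      · have h3 : (1 / 2 : ℝ≥0∞) = ENNReal.ofReal (1 / 2) := by
          rw [ENNReal.ofReal_div_of_pos (by norm_num)]; simp
        rw [h3, ← ENNReal.ofReal_mul p.coe_nonneg, ← ENNReal.ofReal_add (by positivity) (by linarith)]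
        congr 1
        ring
      · rw [mul_one, ← ENNReal.ofReal_add p.coe_nonneg (by linarith)]
        simp
    rw [Finset.prod_congr rfl h1, Finset.prod_ite_mem, Finset.inter_eq_right.2 hA,
      Finset.prod_const]
    have hp' : (p : ℝ) ≤ 1 := hp
    have hp0 : (0 : ℝ) ≤ p := p.2
    rw [← ENNReal.ofReal_pow (by linarith), ← ENNReal.ofReal_mul (Real.exp_pos _).le,
      ← Real.exp_add]
    refine ENNReal.ofReal_le_ofReal ?_
    calc (1 - (p : ℝ) / 2) ^ A.card ≤ Real.exp (-(p / 2)) ^ A.card := by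
          refine pow_le_pow_left₀ (by linarith) ?_ _
          have := Real.add_one_le_exp (-((p : ℝ) / 2))
          linarith
      _ = Real.exp (A.card * (-(p / 2))) := (Real.exp_nat_mul _ _).symm
      _ ≤ _ := Real.exp_le_exp.2 (le_of_eq (by ring))

open Classical in
/-- The points of `X \ O` whose nearest center in `C` is `c`. -/
noncomputable def inlierCluster (near : Finset E → E → E) (C O X : Finset E) (c : E) : Finset E :=
  (X \ O).filter fun x => near C x = c

theorem mem_inlierCluster [DecidableEq E] {C O X : Finset E} {c x : E} :
    x ∈ inlierCluster near C O X c ↔ (x ∈ X ∧ x ∉ O) ∧ near C x = c := by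
  simp [inlierCluster]

/-! ### Faithful samples are coresets -/

variable [MetricSpace E] {near : Finset E → E → E}

/-- The sample `S` represents `X` faithfully with respect to the centers `C` and outliers `O`. -/
structure IsFaithfulSample [DecidableEq E] (near : Finset E → E → E) (X C O : Finset E) (k z : ℕ)
    (p : ℝ) (S : Finset E) : Prop where
  card_outliers : ((S ∩ O).card : ℝ) ≤ 5 / 2 * p * z
  cost_inliers : ∑ x ∈ S \ O, assignCost C x ≤ 10 * (p * ∑ x ∈ X \ O, assignCost C x)
  card_cluster : ∀ c ∈ C, z ≤ k * (inlierCluster near C O X c).card →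
    p * (inlierCluster near C O X c).card / 8 ≤ (inlierCluster near C O S c).card

theorem sum_inlierCluster (hnear : IsNearestRule near) [DecidableEq E] {C : Finset E}
    (hC : C.Nonempty) (O X : Finset E) {M : Type*} [AddCommMonoid M] (f : E → M) :
    ∑ c ∈ C, ∑ x ∈ inlierCluster near C O X c, f x = ∑ x ∈ X \ O, f x := by
  have h := Finset.sum_fiberwise_of_maps_to (s := X \ O) (t := C) (g := near C)
    (fun x _ => (hnear C hC x).1) f
  rw [← h]
  refine Finset.sum_congr rfl fun c _ => Finset.sum_congr ?_ fun _ _ => rfl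
  unfold inlierCluster
  congr!

/-- The cost of a kept cluster is controlled by the cost of its sampled points. -/
theorem cost_inlierCluster_le (hnear : IsNearestRule near) [DecidableEq E] {C : Finset E}
    (hC : C.Nonempty) (O X S D : Finset E) (c : E) {p : ℝ} (hp : 0 < p) {v : E → ℕ}
    (hv : ∀ x ∈ S, v x ≤ 1)
    (h : p * (inlierCluster near C O X c).card ≤ 16 * ∑ x ∈ inlierCluster near C O S c, (v x : ℝ)) :
    ∑ x ∈ inlierCluster near C O X c, assignCost D x ≤
      2 * ∑ x ∈ inlierCluster near C O X c, assignCost C x +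
      64 / p * ∑ x ∈ inlierCluster near C O S c, ((v x : ℝ) * assignCost D x + assignCost C x) := by
  have hdist : ∀ (Z : Finset E), ∀ x ∈ inlierCluster near C O Z c, dist x c ^ 2 = assignCost C x := by
    intro Z x hx
    rw [assignCost_near hnear hC, (mem_inlierCluster.1 hx).2]
  set A := inlierCluster near C O X c
  set B := inlierCluster near C O S c
  -- Both comparisons pass through the center `c`: its cost for `D` bounds that of the cluster, and
  -- is itself bounded by averaging over the kept sampled points.
  have h1 : ∑ x ∈ A, assignCost D x ≤
      2 * (A.card * assignCost D c) + 2 * ∑ x ∈ A, assignCost C x := by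
    have h2 : ∑ x ∈ A, assignCost D x ≤ ∑ x ∈ A, (2 * assignCost D c + 2 * assignCost C x) := by
      refine Finset.sum_le_sum fun x hx => ?_
      rw [← hdist X x hx]
      exact assignCost_le_two_mul D x c
    simp only [Finset.sum_add_distrib, ← Finset.mul_sum, Finset.sum_const, nsmul_eq_mul] at h2
    linarith
  have h2 : (∑ x ∈ B, (v x : ℝ)) * assignCost D c ≤
      2 * ∑ x ∈ B, ((v x : ℝ) * assignCost D x + assignCost C x) := by
    rw [Finset.sum_mul, Finset.mul_sum]
    refine Finset.sum_le_sum fun x hx => ?_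
    have h3 := assignCost_le_two_mul D c x
    rw [dist_comm, hdist S x hx] at h3
    have h4 : (v x : ℝ) ≤ 1 := by exact_mod_cast hv x (mem_inlierCluster.1 hx).1.1
    have h5 : (0 : ℝ) ≤ v x := Nat.cast_nonneg _
    have h6 := assignCost_nonneg C x
    nlinarith
  have h3 := assignCost_nonneg D c
  have h4 : A.card * assignCost D c ≤
      32 / p * ∑ x ∈ B, ((v x : ℝ) * assignCost D x + assignCost C x) := by
    rw [div_mul_eq_mul_div, le_div_iff₀ hp]
    nlinarith
  have h5 : (64 : ℝ) / p = 2 * (32 / p) := by ring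
  rw [h5]
  linarith

/-- The factor 42 is 1 + 1 + 40: the set `O`, at most k small clusters of size at most z/k, and the
large clusters of which at least half the sample was discarded. The last are charged to the
discarded sampled points, at most 5κpz/2 in number, at 16/p points of `X` each. -/
theorem IsFaithfulSample.outlierCost_le (hnear : IsNearestRule near) [DecidableEq E]
    {X C O S D : Finset E} {k z : ℕ} {p κ : ℝ} (h : IsFaithfulSample near X C O k z p S)
    (hOX : O ⊆ X) (hO : O.card ≤ z) (hC : IsCenterSet k C) (hp : 0 < p)
    (hκ : 1 ≤ κ) (hk : 1 ≤ k) :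
    outlierCost (WeightedPoints.ofFinset X) (42 * κ * z) D ≤
      2 * ∑ x ∈ X \ O, assignCost C x + 64 / p *
        (outlierCost (WeightedPoints.ofFinset S) (κ * (5 / 2 * p * z)) D +
          ∑ x ∈ S \ O, assignCost C x) := by
  have hp64 : 0 < 64 / p := by positivity
  suffices hs : (outlierCost (WeightedPoints.ofFinset X) (42 * κ * z) D -
      2 * ∑ x ∈ X \ O, assignCost C x) / (64 / p) - ∑ x ∈ S \ O, assignCost C x ≤
      outlierCost (WeightedPoints.ofFinset S) (κ * (5 / 2 * p * z)) D by
    rw [sub_le_iff_le_add, div_le_iff₀ hp64] at hs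
    linarith
  refine le_outlierCost fun v hv => ?_
  rw [sub_le_iff_le_add, div_le_iff₀ hp64]
  simp only [WeightedPoints.ofFinset, keepChoices, Set.mem_ofPred_eq] at hv ⊢
  set A := inlierCluster near C O X with hA
  set B := inlierCluster near C O S with hB
  -- The clusters kept in full: large ones retaining more than half of their sampled points. All
  -- other points of `X` are discarded.
  let G : Finset E := C.filter fun c => z ≤ k * (A c).card ∧ (B c).card < 2 * ∑ x ∈ B c, v x
  let u : E → ℕ := fun x => if x ∉ O ∧ near C x ∈ G then 1 else 0
  have hGC : G ⊆ C := Finset.filter_subset _ _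
  have hu : ∀ f : E → ℝ, ∑ x ∈ X, (u x : ℝ) * f x = ∑ c ∈ G, ∑ x ∈ A c, f x := by
    intro f
    have h1 : ∑ x ∈ X, (u x : ℝ) * f x = ∑ x ∈ X \ O, (u x : ℝ) * f x := by
      refine (Finset.sum_subset Finset.sdiff_subset fun x hx hx' => ?_).symm
      have : x ∈ O := by simpa [hx] using hx'
      simp [u, this]
    rw [h1, ← sum_inlierCluster hnear hC.1]
    rw [← Finset.sum_subset hGC]
    · refine Finset.sum_congr rfl fun c hc => Finset.sum_congr rfl fun x hx => ?_
      have := mem_inlierCluster.1 hx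
      simp [u, this.1.2, this.2, hc]
    · intro c _ hc
      refine Finset.sum_eq_zero fun x hx => ?_
      have := mem_inlierCluster.1 hx
      simp [u, this.2, hc]
  have hz : (0 : ℝ) ≤ z := Nat.cast_nonneg _
  have hk0 : (0 : ℝ) < k := by exact_mod_cast hk
  have hz' : 0 ≤ κ * (5 / 2 * p * z) := by positivity
  have hdisc : ∑ c ∈ C, ∑ x ∈ B c, (1 - (v x : ℝ)) ≤ κ * (5 / 2 * p * z) := by
    rw [hB, sum_inlierCluster hnear hC.1]
    have h1 : ∑ x ∈ S \ O, (1 - (v x : ℝ)) ≤ ∑ x ∈ S, (1 - (v x : ℝ)) := by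
      refine Finset.sum_le_sum_of_subset_of_nonneg Finset.sdiff_subset fun x hx _ => ?_
      have : (v x : ℝ) ≤ 1 := by exact_mod_cast hv.1 x hx
      linarith
    have h2 : ((∑ y ∈ S, 1 : ℕ) : ℝ) ≤ ((∑ y ∈ S, v y + ⌊κ * (5 / 2 * p * z)⌋₊ : ℕ) : ℝ) := by
      exact_mod_cast hv.2
    push_cast at h2
    simp only [Finset.sum_sub_distrib] at h1 ⊢
    have h3 := Nat.floor_le hz'
    linarith
  have hn : ∀ c ∈ C, c ∉ G → ((A c).card : ℝ) ≤ z / k + 16 / p * ∑ x ∈ B c, (1 - (v x : ℝ)) := by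
    intro c hc hcG
    have h1 : 0 ≤ ∑ x ∈ B c, (1 - (v x : ℝ)) := by
      refine Finset.sum_nonneg fun x hx => ?_
      have : (v x : ℝ) ≤ 1 := by exact_mod_cast hv.1 x (mem_inlierCluster.1 hx).1.1
      linarith
    by_cases hbig : z ≤ k * (A c).card
    · have h2 := h.card_cluster c hc hbig
      have h3 : 2 * ∑ x ∈ B c, v x ≤ (B c).card := by
        by_contra h3
        exact hcG (Finset.mem_filter.2 ⟨hc, hbig, not_le.1 h3⟩)
      have h3' : 2 * ∑ x ∈ B c, (v x : ℝ) ≤ (B c).card := by exact_mod_cast h3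
      rw [Finset.sum_sub_distrib, Finset.sum_const, nsmul_eq_mul, mul_one]
      have h4 : ((A c).card : ℝ) ≤ 16 / p * ((B c).card - ∑ x ∈ B c, (v x : ℝ)) := by
        rw [div_mul_eq_mul_div, le_div_iff₀ hp]
        simp only [← hA, ← hB] at h2
        linarith
      have : 0 ≤ (z : ℝ) / k := by positivity
      linarith
    · have h2 : ((A c).card : ℝ) ≤ z / k := by
        rw [le_div_iff₀ hk0]
        have : (k : ℝ) * (A c).card ≤ z := by exact_mod_cast (not_le.1 hbig).le
        linarith
      have : 0 ≤ 16 / p * ∑ x ∈ B c, (1 - (v x : ℝ)) := by positivity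
      linarith
  have hmem : u ∈ keepChoices (WeightedPoints.ofFinset X) (42 * κ * z) := by
    refine ⟨fun x _ => ?_, ?_⟩
    · simp only [u, WeightedPoints.ofFinset]
      split_ifs <;> simp
    · simp only [WeightedPoints.ofFinset]
      rw [add_comm, ← Nat.sub_le_iff_le_add]
      refine Nat.le_floor ?_
      rw [Nat.cast_sub (Finset.sum_le_sum fun x _ => by simp only [u]; split_ifs <;> simp)]
      have h1 := hu fun _ => 1
      simp only [mul_one] at h1
      have h2 : ∑ x ∈ X, (1 : ℝ) = O.card + ∑ c ∈ C, ((A c).card : ℝ) := by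
        rw [← Finset.sum_sdiff hOX, ← sum_inlierCluster hnear hC.1]
        simp [add_comm, hA]
      have h3 := Finset.sum_sdiff hGC (f := fun c => ((A c).card : ℝ))
      have h4 : ∑ c ∈ C \ G, ((A c).card : ℝ) ≤
          ∑ c ∈ C, ((z : ℝ) / k + 16 / p * ∑ x ∈ B c, (1 - (v x : ℝ))) := by
        refine (Finset.sum_le_sum fun c hc => hn c (Finset.mem_sdiff.1 hc).1
          (Finset.mem_sdiff.1 hc).2).trans
          (Finset.sum_le_sum_of_subset_of_nonneg Finset.sdiff_subset fun c _ _ => ?_)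
        have : 0 ≤ ∑ x ∈ B c, (1 - (v x : ℝ)) := by
          refine Finset.sum_nonneg fun x hx => ?_
          have : (v x : ℝ) ≤ 1 := by exact_mod_cast hv.1 x (mem_inlierCluster.1 hx).1.1
          linarith
        positivity
      rw [Finset.sum_add_distrib, ← Finset.mul_sum, Finset.sum_const, nsmul_eq_mul] at h4
      have h5 : (C.card : ℝ) * (z / k) ≤ z := by
        have : (C.card : ℝ) ≤ k := by exact_mod_cast hC.2
        calc (C.card : ℝ) * (z / k) ≤ k * (z / k) := by gcongr
          _ = z := by field_simp
      have h6 : 16 / p * ∑ c ∈ C, ∑ x ∈ B c, (1 - (v x : ℝ)) ≤ 40 * (κ * z) := by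
        calc _ ≤ 16 / p * (κ * (5 / 2 * p * z)) := by gcongr
          _ = 40 * (κ * z) := by field_simp; ring
      have h7 : (O.card : ℝ) ≤ z := by exact_mod_cast hO
      have h8 : (z : ℝ) ≤ κ * z := le_mul_of_one_le_left hz hκ
      simp only [Finset.sum_const, nsmul_eq_mul, mul_one] at h1 h2
      push_cast
      simp only [Finset.sum_const, nsmul_eq_mul, mul_one]
      linarith
  refine (sub_le_sub_right (_root_.outlierCost_le D hmem) _).trans ?_
  simp only [WeightedPoints.ofFinset]
  rw [hu (assignCost D), sub_le_iff_le_add]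
  have hcost : ∑ c ∈ G, ∑ x ∈ A c, assignCost D x ≤ ∑ c ∈ C, (2 * ∑ x ∈ A c, assignCost C x +
      64 / p * ∑ x ∈ B c, ((v x : ℝ) * assignCost D x + assignCost C x)) := by
    refine (Finset.sum_le_sum fun c hc => ?_).trans
      (Finset.sum_le_sum_of_subset_of_nonneg hGC fun c _ _ => ?_)
    · have hc' := Finset.mem_filter.1 hc
      refine cost_inlierCluster_le hnear hC.1 O X S D c hp hv.1 ?_
      have h1 := h.card_cluster c hc'.1 hc'.2.1
      have h2 : ((B c).card : ℝ) ≤ 2 * ∑ x ∈ B c, (v x : ℝ) := by exact_mod_cast hc'.2.2.le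
      simp only [← hA, ← hB] at h1 ⊢
      linarith
    · have h1 : 0 ≤ ∑ x ∈ A c, assignCost C x := Finset.sum_nonneg fun _ _ => assignCost_nonneg _ _
      have h2 : 0 ≤ ∑ x ∈ B c, ((v x : ℝ) * assignCost D x + assignCost C x) :=
        Finset.sum_nonneg fun x _ => add_nonneg
          (mul_nonneg (Nat.cast_nonneg _) (assignCost_nonneg _ _)) (assignCost_nonneg _ _)
      positivity
  rw [Finset.sum_add_distrib, ← Finset.mul_sum, ← Finset.mul_sum, hA, hB,
    sum_inlierCluster hnear hC.1, sum_inlierCluster hnear hC.1, Finset.sum_add_distrib] at hcost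
  have hS : ∑ x ∈ S \ O, (v x : ℝ) * assignCost D x ≤ ∑ x ∈ S, (v x : ℝ) * assignCost D x :=
    Finset.sum_le_sum_of_subset_of_nonneg Finset.sdiff_subset fun x _ _ =>
      mul_nonneg (Nat.cast_nonneg _) (assignCost_nonneg _ _)
  have hS' := mul_le_mul_of_nonneg_left hS hp64.le
  rw [mul_add] at hcost
  linarith

/-- A faithful sample is a coreset. -/
theorem IsFaithfulSample.isCoreset (hnear : IsNearestRule near) [DecidableEq E]
    {X C O S : Finset E} {k z : ℕ} {p : ℝ} (h : IsFaithfulSample near X C O k z p S)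
    (hOX : O ⊆ X) (hO : O.card ≤ z) (hC : IsCenterSet k C) (hp : 0 < p)
    (hk : 1 ≤ k)
    (hopt : ∑ x ∈ X \ O, assignCost C x ≤ 4 * optCost (WeightedPoints.ofFinset X) k z) :
    IsCoreset k (WeightedPoints.ofFinset S) (5 / 2 * p * z) (WeightedPoints.ofFinset X) z
      42 5128 := by
  intro κ₁ κ₂ hκ₁ hκ₂ D _ hle
  have hz' : 0 ≤ 5 / 2 * p * z := by positivity
  have h1 := h.outlierCost_le hnear (D := D) hOX hO hC hp hκ₁ hk
  set M := ∑ x ∈ X \ O, assignCost C x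
  have hM : 0 ≤ M := Finset.sum_nonneg fun _ _ => assignCost_nonneg _ _
  -- `C` with the sampled part of `O` discarded is feasible for the sample, precisely because `S ∩
  -- O` has at most z' = 5pz/2 elements.
  have h2 : optCost (WeightedPoints.ofFinset S) k (5 / 2 * p * z) ≤
      ∑ x ∈ S \ O, assignCost C x := by
    refine (optCost_le _ _ hC).trans ((_root_.outlierCost_le C
      (v := fun x => if x ∈ O then 0 else 1) ⟨fun x _ => ?_, ?_⟩).trans (le_of_eq ?_))
    · simp only [WeightedPoints.ofFinset]
      split_ifs <;> simp
    · simp only [WeightedPoints.ofFinset]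
      have h3 : ∑ y ∈ S, 1 = ∑ y ∈ S, (if y ∈ O then 0 else 1) + (S ∩ O).card := by
        rw [← Finset.filter_mem_eq_inter, Finset.card_filter, ← Finset.sum_add_distrib]
        refine Finset.sum_congr rfl fun x _ => ?_
        split_ifs <;> rfl
      rw [h3]
      exact Nat.add_le_add_left (Nat.le_floor h.card_outliers) _
    · simp only [WeightedPoints.ofFinset, Finset.sdiff_eq_filter, Finset.sum_filter]
      refine Finset.sum_congr rfl fun x _ => ?_
      split_ifs <;> simp
  have h3 := h.cost_inliers
  have h4 : outlierCost (WeightedPoints.ofFinset S) (κ₁ * (5 / 2 * p * z)) D +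
      ∑ x ∈ S \ O, assignCost C x ≤ 20 * κ₂ * (p * M) := by
    have h5 := mul_le_mul_of_nonneg_left (h2.trans h3) (by linarith : 0 ≤ κ₂)
    have h6 : 0 ≤ p * M := by positivity
    nlinarith
  have h5 : 64 / p * (outlierCost (WeightedPoints.ofFinset S) (κ₁ * (5 / 2 * p * z)) D +
      ∑ x ∈ S \ O, assignCost C x) ≤ 1280 * κ₂ * M := by
    calc _ ≤ 64 / p * (20 * κ₂ * (p * M)) := by gcongr
      _ = 1280 * κ₂ * M := by field_simp; ring
  -- The total is at most (2 + 1280)κ₂M, and M ≤ 4 Opt gives 4 · 1282 = 5128.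
  have h6 : M ≤ κ₂ * M := le_mul_of_one_le_left hM hκ₂
  have h7 := mul_le_mul_of_nonneg_left hopt (by linarith : 0 ≤ κ₂)
  linarith

end Sampling

/-! ### Success probability and size of SampleCoreset -/

section SampleCoreset

variable {E : Type*} [MetricSpace E] {near : Finset E → E → E}

/-- A cluster of size at least z/k has expected sample size at least 36 log(2k³), so its failure
probability is small enough for a union bound over k clusters. Only the second term of the sampling
rate is needed. -/
theorem exp_chernoff_le {k z n : ℕ} {p : ℝ} (hk : 1 ≤ k) (hz : 1 ≤ z)
    (hp : 36 * (k / z : ℝ) * Real.log (2 * k ^ 3) ≤ p) (hn : z ≤ k * n) :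
    Real.exp (-(3 / 8 * (p * n))) ≤ 1 / (8 * k) := by
  have hk1 : (1 : ℝ) ≤ k := by exact_mod_cast hk
  have hz1 : (1 : ℝ) ≤ z := by exact_mod_cast hz
  have hk3 : (1 : ℝ) ≤ k ^ 3 := one_le_pow₀ hk1
  have hkk3 : (k : ℝ) ≤ k ^ 3 := le_self_pow₀ hk1 (by norm_num)
  have hlog : 0 ≤ Real.log (2 * k ^ 3) := Real.log_nonneg (by linarith)
  have h1 : (z : ℝ) ≤ k * n := by exact_mod_cast hn
  have h2 : 36 * Real.log (2 * k ^ 3) ≤ p * n := by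
    calc 36 * Real.log (2 * k ^ 3) = 36 * Real.log (2 * k ^ 3) / z * z := by field_simp
      _ ≤ 36 * Real.log (2 * k ^ 3) / z * (k * n) := by gcongr
      _ = 36 * (k / z : ℝ) * Real.log (2 * k ^ 3) * n := by ring
      _ ≤ p * n := by gcongr
  calc Real.exp (-(3 / 8 * (p * n))) ≤ Real.exp (-((3 : ℕ) * Real.log (2 * k ^ 3))) :=
        Real.exp_le_exp.2 (by push_cast; linarith)
    _ = 1 / (2 * k ^ 3) ^ 3 := by
        rw [Real.exp_neg, Real.exp_nat_mul, Real.exp_log (by positivity), one_div]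
    _ ≤ 1 / (8 * k) := by
        refine one_div_le_one_div_of_le (by positivity) ?_
        have : (k : ℝ) ^ 3 ≤ (k ^ 3) ^ 3 := le_self_pow₀ hk3 (by norm_num)
        nlinarith

/-- A random sample is faithful with constant probability. -/
theorem bernoulliSubset_isFaithfulSample [DecidableEq E] {X C O : Finset E} {k z : ℕ} {p : ℝ≥0}
    (hp1 : p ≤ 1) (hp0 : 0 < p) (hOX : O ⊆ X) (hO : O.card ≤ z) (hC : C.card ≤ k) (hk : 1 ≤ k)
    (hz : 1 ≤ z) (hp : 36 * (k / z : ℝ) * Real.log (2 * k ^ 3) ≤ p) :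
    ENNReal.ofReal (3 / 8) ≤
      (bernoulliSubset X p hp1).toOuterMeasure {S | IsFaithfulSample near X C O k z p S} := by
  classical
  set M := ∑ x ∈ X \ O, assignCost C x with hM
  set A := inlierCluster near C O X with hA
  have hk0 : (0 : ℝ) < k := by exact_mod_cast hk
  -- The failure events have probabilities at most 2/5 and 1/10 by Markov, and 1/8 by Chernoff with
  -- a union bound: 5/8 in total.
  let E₁ : Set (Finset E) := {S | 5 / 2 * (p * (z : ℝ)) < ∑ x ∈ S, if x ∈ O then 1 else 0}
  let E₂ : Set (Finset E) := {S | 10 * (p * M) < ∑ x ∈ S, if x ∈ O then 0 else assignCost C x}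
  let E₃ : E → Set (Finset E) := fun c => {S | ((S ∩ A c).card : ℝ) < p * (A c).card / 8}
  set μ := (bernoulliSubset X p hp1).toOuterMeasure with hμ
  have h₁ : μ E₁ ≤ ENNReal.ofReal (2 / 5) := by
    refine (bernoulliSubset_sum_gt_le X hp1 hp0 (fun x => ?_) (by norm_num) ?_).trans
      (ENNReal.ofReal_le_ofReal (by norm_num))
    · split_ifs <;> norm_num
    · rw [Finset.sum_ite_mem, Finset.inter_eq_right.2 hOX]
      simpa using hO
  have h₂ : μ E₂ ≤ ENNReal.ofReal (1 / 10) := by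
    refine bernoulliSubset_sum_gt_le X hp1 hp0 (fun x => ?_) (by norm_num) (le_of_eq ?_)
    · split_ifs
      exacts [le_rfl, assignCost_nonneg _ _]
    · rw [hM, Finset.sdiff_eq_filter, Finset.sum_filter]
      exact Finset.sum_congr rfl fun x _ => by split_ifs <;> rfl
  have h₃ : μ (⋃ c ∈ C.filter fun c => z ≤ k * (A c).card, E₃ c) ≤ ENNReal.ofReal (1 / 8) := by
    refine (MeasureTheory.measure_biUnion_finset_le _ _).trans
      ((Finset.sum_le_card_nsmul _ _ (ENNReal.ofReal (1 / (8 * k))) fun c hc => ?_).trans ?_)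
    · refine (bernoulliSubset_card_inter_lt_le (fun x hx => (mem_inlierCluster.1 hx).1.1)
        hp1).trans (ENNReal.ofReal_le_ofReal ?_)
      exact exp_chernoff_le hk hz hp (Finset.mem_filter.1 hc).2
    · rw [nsmul_eq_mul, ← ENNReal.ofReal_natCast, ← ENNReal.ofReal_mul (Nat.cast_nonneg _)]
      refine ENNReal.ofReal_le_ofReal ?_
      have h4 : ((C.filter fun c => z ≤ k * (A c).card).card : ℝ) ≤ k := by
        exact_mod_cast (Finset.card_filter_le _ _).trans hC
      calc _ ≤ (k : ℝ) * (1 / (8 * k)) := by gcongr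
        _ = 1 / 8 := by field_simp
  have hsub : {S | IsFaithfulSample near X C O k z p S}ᶜ ⊆
      E₁ ∪ E₂ ∪ ⋃ c ∈ C.filter fun c => z ≤ k * (A c).card, E₃ c := by
    intro S hS
    by_contra hcon
    simp only [Set.mem_union, not_or, Set.mem_iUnion, not_exists] at hcon
    obtain ⟨⟨hc₁, hc₂⟩, hc₃⟩ := hcon
    refine hS ⟨?_, ?_, fun c hc hbig => ?_⟩
    · have : ∑ x ∈ S, (if x ∈ O then (1 : ℝ) else 0) ≤ 5 / 2 * (p * (z : ℝ)) := not_lt.1 hc₁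
      rw [Finset.sum_ite_mem, Finset.sum_const, nsmul_eq_mul, mul_one] at this
      linarith
    · have : ∑ x ∈ S, (if x ∈ O then 0 else assignCost C x) ≤ 10 * (p * M) := not_lt.1 hc₂
      rw [Finset.sdiff_eq_filter, Finset.sum_filter]
      refine le_trans (le_of_eq (Finset.sum_congr rfl fun x _ => ?_)) this
      split_ifs <;> rfl
    · refine (not_lt.1 (hc₃ c (Finset.mem_filter.2 ⟨hc, hbig⟩))).trans ?_
      refine Nat.cast_le.2 (Finset.card_le_card fun x hx => ?_)
      rw [Finset.mem_inter, hA, mem_inlierCluster] at hx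
      exact mem_inlierCluster.2 ⟨⟨hx.1, hx.2.1.2⟩, hx.2.2⟩
  have h5 : μ {S | IsFaithfulSample near X C O k z p S}ᶜ ≤ ENNReal.ofReal (5 / 8) := by
    refine (MeasureTheory.measure_mono hsub).trans ((MeasureTheory.measure_union_le _ _).trans
      ((add_le_add ((MeasureTheory.measure_union_le _ _).trans (add_le_add h₁ h₂)) h₃).trans ?_))
    rw [← ENNReal.ofReal_add (by norm_num) (by norm_num),
      ← ENNReal.ofReal_add (by norm_num) (by norm_num)]
    exact ENNReal.ofReal_le_ofReal (by norm_num)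
  refine le_trans ?_ (PMF.one_sub_le_toOuterMeasure _ _ h5)
  rw [← ENNReal.ofReal_one, ← ENNReal.ofReal_sub _ (by norm_num)]
  exact ENNReal.ofReal_le_ofReal (by norm_num)

theorem sampleRate_pos {n k z : ℕ} (hk : 1 ≤ k) (hz : z ≠ 0) : 0 < sampleRate n k z := by
  have hk1 : (1 : ℝ) ≤ k := by exact_mod_cast hk
  have hz1 : (0 : ℝ) < z := by exact_mod_cast Nat.pos_of_ne_zero hz
  have hk3 : (1 : ℝ) ≤ k ^ 3 := one_le_pow₀ hk1
  have hlog : 0 < Real.log (2 * k ^ 3) := Real.log_pos (by linarith)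
  exact lt_max_of_lt_right (by positivity)

/-- A random sample at the sampling rate is a coreset with constant probability. -/
theorem bernoulliSubset_isCoreset (hnear : IsNearestRule near) (X : Finset E) {k z : ℕ}
    {p : ℝ≥0} (hp1 : p ≤ 1) (hp0 : 0 < p) (hk : 1 ≤ k) (hz : 1 ≤ z)
    (hp : 36 * (k / z : ℝ) * Real.log (2 * k ^ 3) ≤ p) :
    ENNReal.ofReal (3 / 8) ≤ (bernoulliSubset X p hp1).toOuterMeasure
      {S | IsCoreset k (WeightedPoints.ofFinset S) (5 / 2 * p * z)
        (WeightedPoints.ofFinset X) z 42 5128} := by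
  classical
  rcases X.eq_empty_or_nonempty with rfl | hX
  · refine le_trans ?_ (PMF.le_toOuterMeasure_of_support _ fun S _ =>
      isCoreset_empty k _ _ _ (by norm_num))
    exact ENNReal.ofReal_le_one.2 (by norm_num)
  obtain ⟨C, O, hC, hOX, hO, hcost⟩ := exists_centers_outliers hnear hX hk (z : ℝ)
  rw [Nat.floor_natCast] at hO
  refine (bernoulliSubset_isFaithfulSample (near := near) hp1 hp0 hOX hO hC.2 hk hz hp).trans
    (MeasureTheory.measure_mono fun S hS => ?_)
  exact IsFaithfulSample.isCoreset hnear hS hOX hO hC hp0 hk hcost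

theorem kmeansPP_card_le {X : Finset E} {m : ℕ} {Y : WeightedPoints E}
    (h : kmeansPP near X m Y ≠ 0) : Y.points.card ≤ X.card ∧ Y.points.card ≤ m := by
  rw [kmeansPP, ← PMF.mem_support_iff, PMF.mem_support_map_iff] at h
  obtain ⟨Z, hZ, rfl⟩ := h
  have := kmeansPPCenters_support ((PMF.mem_support_iff _ _).1 hZ)
  exact ⟨Finset.card_le_card this.1, this.2.1⟩

/-- For k ≤ n and n ≥ 2 the two logarithms are at most those of n⁵ and n⁴, so the terms of pz are at
most 36 · 5 log n and 36 · 4 k log n. -/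
theorem sampleRate_mul_le {n k z : ℕ} (hk : 1 ≤ k) (hkn : k ≤ n) (hn : 2 ≤ n) (hz : z ≠ 0) :
    sampleRate n k z * z ≤ 180 * (k * Real.log n) := by
  have hk1 : (1 : ℝ) ≤ k := by exact_mod_cast hk
  have hkn' : (k : ℝ) ≤ n := by exact_mod_cast hkn
  have hn2 : (2 : ℝ) ≤ n := by exact_mod_cast hn
  have hz1 : (1 : ℝ) ≤ z := by exact_mod_cast Nat.pos_of_ne_zero hz
  have hL : 0 ≤ Real.log n := Real.log_nonneg (by linarith)
  have hkL : Real.log n ≤ k * Real.log n := le_mul_of_one_le_left hL hk1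
  have h1 : Real.log (4 * n * k ^ 2 / z) ≤ 5 * Real.log n := by
    rw [show (5 : ℝ) * Real.log n = (5 : ℕ) * Real.log n by norm_num, ← Real.log_pow]
    refine Real.log_le_log (by positivity) ?_
    calc 4 * (n : ℝ) * k ^ 2 / z ≤ 4 * n * k ^ 2 := div_le_self (by positivity) hz1
      _ ≤ (n * n) * n * n ^ 2 := by gcongr; nlinarith
      _ = n ^ 5 := by ring
  have h2 : Real.log (2 * k ^ 3) ≤ 4 * Real.log n := by
    rw [show (4 : ℝ) * Real.log n = (4 : ℕ) * Real.log n by norm_num, ← Real.log_pow]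
    refine Real.log_le_log (by positivity) ?_
    calc 2 * (k : ℝ) ^ 3 ≤ (n : ℝ) * (n : ℝ) ^ 3 := by gcongr
      _ = (n : ℝ) ^ 4 := by ring
  rw [← le_div_iff₀ (by linarith)]
  refine max_le ?_ ?_
  · rw [div_mul_eq_mul_div]
    exact div_le_div_of_nonneg_right (by linarith) (by linarith)
  · have : 36 * (k / z : ℝ) * Real.log (2 * k ^ 3) = 36 * (k * Real.log (2 * k ^ 3)) / z := by ring
    rw [this]
    exact div_le_div_of_nonneg_right (by nlinarith) (by linarith)

/-- This holds for every possible output. If n ≤ k, the bound |Y| ≤ n suffices. Otherwise the number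
of picks is O(k + pz), since without subsampling either z = 0 or p > 1, and so z ≤ pz. The summands
k and 1 are absorbed using log n ≥ 1/2. -/
theorem sampleCoreset_card_le {X : Finset E} {k z : ℕ} (hk : 1 ≤ k) (hX : 2 ≤ X.card)
    {Y : WeightedPoints E} (h : sampleCoreset near X k z Y ≠ 0) :
    (Y.points.card : ℝ) ≤ 14500 * (k * Real.log X.card) := by
  have hk1 : (1 : ℝ) ≤ k := by exact_mod_cast hk
  have hL : 1 / 2 ≤ Real.log X.card := by
    have h1 := Real.log_two_gt_d9
    have h2 : Real.log 2 ≤ Real.log X.card :=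
      Real.log_le_log (by norm_num) (by exact_mod_cast hX)
    linarith
  have hkL : (k : ℝ) ≤ 2 * (k * Real.log X.card) := by nlinarith
  have key : Y.points.card ≤ X.card ∧ (X.card ≤ k ∨
      (Y.points.card : ℝ) ≤ 14500 * (k * Real.log X.card)) := by
    unfold sampleCoreset at h
    split_ifs at h with hs
    · rw [← PMF.mem_support_iff, PMF.mem_support_bind_iff] at h
      obtain ⟨S, hS, hY⟩ := h
      have h1 := kmeansPP_card_le ((PMF.mem_support_iff _ _).1 hY)
      have h2 := Finset.card_le_card (bernoulliSubset_support ((PMF.mem_support_iff _ _).1 hS))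
      refine ⟨h1.1.trans h2, (le_total X.card k).imp_right fun hkn => ?_⟩
      have h3 := sampleRate_mul_le hk hkn hX hs.1
      have h4 : (0 : ℝ) ≤ sampleRate X.card k z * z :=
        mul_nonneg (sampleRate_pos hk hs.1).le (Nat.cast_nonneg _)
      have h5 : (Y.points.card : ℝ) ≤
          ⌈32 * ((k : ℝ) + 5 / 2 * sampleRate X.card k z * z)⌉₊ := by exact_mod_cast h1.2
      have h6 := Nat.ceil_lt_add_one (a := 32 * ((k : ℝ) + 5 / 2 * sampleRate X.card k z * z))
        (by nlinarith)
      linarith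
    · have h1 := kmeansPP_card_le h
      refine ⟨h1.1, (le_total X.card k).imp_right fun hkn => ?_⟩
      have h2 : (Y.points.card : ℝ) ≤ 32 * (k + z) := by exact_mod_cast h1.2
      have h3 : (z : ℝ) ≤ 180 * (k * Real.log X.card) := by
        by_cases hz : z = 0
        · subst hz
          push_cast
          positivity
        · have h4 : 1 < sampleRate X.card k z := by
            by_contra h4
            exact hs ⟨hz, not_lt.1 h4⟩
          exact (le_mul_of_one_le_left (Nat.cast_nonneg _) h4.le).trans
            (sampleRate_mul_le hk hkn hX hz)
      linarith
  rcases key.2 with h1 | h1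
  · have h2 : (Y.points.card : ℝ) ≤ k := by exact_mod_cast key.1.trans h1
    linarith
  · exact h1

theorem le_one_sub_four_div : ENNReal.ofReal (2 / 3) ≤ 1 - 4 / 31 := by
  have h : (4 / 31 : ℝ≥0∞) = ENNReal.ofReal (4 / 31) := by
    rw [ENNReal.ofReal_div_of_pos (by norm_num)]
    norm_num
  rw [h, ← ENNReal.ofReal_one, ← ENNReal.ofReal_sub _ (by norm_num)]
  exact ENNReal.ofReal_le_ofReal (by norm_num)

/-- With subsampling the stages succeed with probability at least 3/8 and 27/31 ≥ 2/3, whose product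
gives 1/4, and the two coresets compose. Without it, k-means++ alone is stronger than required. -/
theorem sampleCoreset_isCoreset (hnear : IsNearestRule near) (X : Finset E) {k : ℕ} (z : ℕ)
    (hk : 1 ≤ k) :
    ENNReal.ofReal (1 / 4) ≤ (sampleCoreset near X k z).toOuterMeasure
      {Y | IsCoreset k Y (coresetOutliers X.card k z) (WeightedPoints.ofFinset X) z
        42 (2020 * 5128)} := by
  unfold sampleCoreset coresetOutliers
  split_ifs with hs
  · have hp := sampleRate_pos (n := X.card) hk hs.1
    set r := sampleRate X.card k z with hr
    have hrp : ((r.toNNReal : ℝ≥0) : ℝ) = r := Real.coe_toNNReal _ hp.le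
    have h1 := bernoulliSubset_isCoreset hnear X (Real.toNNReal_le_one.2 hs.2)
      (Real.toNNReal_pos.2 hp) hk (Nat.one_le_iff_ne_zero.2 hs.1)
      (by rw [hrp, hr]; exact le_max_right _ _)
    rw [hrp] at h1
    refine le_trans ?_ (PMF.mul_le_toOuterMeasure_bind _ _ _ _ h1 fun S hS =>
      le_one_sub_four_div.trans ((kmeansPP_isCoreset hnear S hk (5 / 2 * r * z) ?_).trans
        (MeasureTheory.measure_mono fun Y hY => ?_)))
    · rw [← ENNReal.ofReal_mul (by norm_num)]
      exact ENNReal.ofReal_le_ofReal (by norm_num)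
    · refine Nat.cast_le.1 (le_trans ?_ (Nat.le_ceil (32 * ((k : ℝ) + 5 / 2 * r * z))))
      push_cast
      have := Nat.floor_le (a := 5 / 2 * r * z) (by positivity)
      linarith
    · have := IsCoreset.trans hY hS le_rfl (by norm_num)
      rwa [one_mul] at this
  · refine le_trans ?_ (le_one_sub_four_div.trans
      ((kmeansPP_isCoreset hnear X hk (z : ℝ) (by rw [Nat.floor_natCast])).trans
        (MeasureTheory.measure_mono fun Y hY => ?_)))
    · exact ENNReal.ofReal_le_ofReal (by norm_num)
    · exact IsCoreset.mono hY (Nat.cast_nonneg _) (by norm_num) (by norm_num)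

end SampleCoreset

theorem mainTheorem3 :
    ∃ c α β K : ℝ, 0 < c ∧ 0 < α ∧ 0 < β ∧ 0 < K ∧
      ∀ (d k z : ℕ) (X : Finset (EuclideanSpace ℝ (Fin d)))
        (near : Finset (EuclideanSpace ℝ (Fin d)) → EuclideanSpace ℝ (Fin d) →
          EuclideanSpace ℝ (Fin d)),
        1 ≤ k → IsNearestRule near →
          ENNReal.ofReal c ≤ (sampleCoreset near X k z).toOuterMeasure
            {Y | IsCoreset k Y (coresetOutliers X.card k z) (WeightedPoints.ofFinset X) z α β} ∧
          (2 ≤ X.card →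
            ∑' Y, sampleCoreset near X k z Y * (Y.points.card : ENNReal) ≤
              ENNReal.ofReal (K * (k * Real.log X.card))) := by
  refine ⟨1 / 4, 42, 2020 * 5128, 14500, by norm_num, by norm_num, by norm_num, by norm_num,
    fun d k z X near hk hnear => ⟨sampleCoreset_isCoreset hnear X z hk, fun hX => ?_⟩⟩
  -- The bound on the size holds surely, so it passes to the expectation.
  refine ((sampleCoreset near X k z).expect_mono fun Y hY => ?_).trans (PMF.expect_const _ _).le
  rw [← ENNReal.ofReal_natCast]
  exact ENNReal.ofReal_le_ofReal (sampleCoreset_card_le hk hX hY)
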